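/- **Setting.** Let $A$ be a nonempty separable metric space, $d,d_1\ge 1$ integers, $T,h_0\in(0,\infty)$, $\delta\in(0,1]$, $K_0,K_3\in[0,\infty)$, $m\in\mathbb R$, $\tau,h>0$, $\eta\in(0,h]$, and let $l\in\mathbb R^d$ with $|l|\le K_0$. Indices $i,j,k$ run through $\{\pm1,\dots,\pm d_1\}$. Let vectors $\ell_k\in\mathbb R^d$ (not necessarily distinct or nonzero) and real functions $r^\alpha(t)$, $a_k^\alpha(t,x)$, $b_k^\alpha(t,x)$, $c^\alpha(t,x)$, $f^\alpha(t,x)$ be given on $A\times\mathbb R\times\mathbb R^d$. Put $s^\pm=\frac12(|s|\pm s)$ and $$\delta_{\rho,e}\varphi(x)=\frac{\varphi(x+\rho e)-\varphi(x)}{\rho},\quad \Delta_{\rho,e}\varphi(x)=\frac{\varphi(x+\rho e)-2\varphi(x)+\varphi(x-\rho e)}{\rho^2},$$ $$\tau_T(t)=\tau\wedge(T-t)^+,\quad \delta^T_\tau u(t,x)=\frac{u(t+\tau_T(t),x)-u(t,x)}{\tau}.$$ **Assumptions** (for all values of the arguments). 1. $r^\alpha,a^\alpha_k,b^\alpha_k,c^\alpha$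 are continuous in $\alpha$; $b^\alpha_k$ and $c^\alpha$ are Lipschitz in $x$ with constants $K_0$ and $K_3$, respectively; $\ell_{-k}=-\ell_k$, $a^\alpha_{-k}=a^\alpha_k$, $|\ell_k|\le K_0$, $r^\alpha\ge0$, $a^\alpha_k\ge0$. 2. $|\delta_{\rho,e}a^\alpha_k|\le K_0(\sqrt{a^\alpha_k}+\rho)$ for every unit vector $e\in\mathbb R^d$ and every $\rho>0$. 3. $a^\alpha_k\ge h_0(b^\alpha_k)^-$. 4. For any two pairs $(\rho,e),(\rho',e')$ from the list consisting of $(h,\ell_k)$, $k=\pm1,\dots,\pm d_1$, $(\eta,l)$ and $(\eta,-l)$, we have $|\delta_{\rho',e'}\delta_{\rho,e}\psi|\le K_3$ for $\psi=b^\alpha_k,c^\alpha,f^\alpha$, and $|\delta_{\rho,e}f^\alpha|\le K_3$, and $|\delta_{\rho',e'}\delta_{\rho,e}a^\alpha_k|\le K_0+K_3\sqrt{a_k^\alpha}$. 5. $\delta\le\sup_{\alpha\in A}a^\alpha_k(t,x)\le K_0$ for every $k,t,x$, and $r^\alpha,|b^\alpha_k|,|c^\alpha|,|f^\alpha|\le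 K_3$. 6. There is an integer $1\le d_0<d_1$ such that, with $\mathcal L=\{\ell_{\pm1},\dots,\ell_{\pm d_0}\}$, each $\ell_k$ with $d_0<|k|\le d_1$ equals $l_1+l_2$ for some $l_1,l_2\in\mathcal L$ with $l_1\ne\pm l_2$; and, conversely, for all $l_1,l_2\in\mathcal L$ with $l_1\neq\pm l_2$ the vector $l_1+l_2$ is one of the $\ell_k$, $|k|\le d_1$. **Grid.** Let $\Lambda_0=\{h\ell_k\}$, $\Lambda=\Lambda_0\cup\{\eta l,-\eta l\}$, let $\Lambda_\infty$ be the set of all sums of $n\ge1$ elements of $\Lambda$, $\bar{\mathcal M}_T=\{(n\tau)\wedge T:n=0,1,\dots\}\times\Lambda_\infty$ and $\mathcal M_T=\bar{\mathcal M}_T\cap([0,T)\times\mathbb R^d)$. Let $Q\subset\mathcal M_T$ be finite with $Q|_0:=Q\cap(\{0\}\times\mathbb R^d)\ne\emptyset$, and put $$\bar Q=Q\cup\{(t+\tau_T(t),x):(t,x)\in Q,\ t+\tau_T(t)=T\},$$ $$Q^o_2=\{(t,x)\in Q:\ t<T,\ (t+\tau_T(t),x)\in\bar Q,\ (t,x+\Lambda_0+\Lambda_0)\subset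 Q\},\qquad \partial_2Q=\bar Q\setminus Q^o_2 .$$ Let $T'$ be the least $n\tau$, $n=1,2,\dots$, with $n\tau\ge T$; $\xi(t)=e^{mt}$ for $t<T$, $\xi(T)=e^{mT'}$, $\xi_{(-)}=\xi\wedge1$; $c_m=(1-e^{-m\tau})/\tau$ and $\lambda=\inf_{\alpha,t,x}[c^\alpha(t,x)+r^\alpha(t)c_m]$. Let $u$ be a function on $\bar{\mathcal M}_T$ satisfying in $Q$ $$\sup_{\alpha\in A}\Big[r^\alpha\delta^T_\tau u+\sum_{k}\big(a^\alpha_k\Delta_{h,\ell_k}u+b^\alpha_k\delta_{h,\ell_k}u\big)-c^\alpha u+f^\alpha\Big]=0 .$$ **Claim.** There is a constant $N=N(\delta,d_1,K_0)$ and a constant $N^*=N^*(h_0,\delta,d_1,K_0,K_3)$ such that, if $\lambda\ge N$, then on $Q|_0$ for all $i,j=\pm1,\dots,\pm d_1$ $$|\delta_{h,\ell_j}\delta_{h,\ell_i}u|\le N^*e^{m^+(T+\tau)}R,$$ $$R=1+\max_{\bar Q}|\xi_{(-)}u|+\max_Q(\xi_{(-)}\delta^T_\tau u)^-+\max_{i,j}\max_{\partial_2Q}|\xi_{(-)}\delta_{h,\ell_i}\delta_{h,\ell_j}u|+\max_i\max_{\bar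 Q}|\xi_{(-)}\delta_{h,\ell_i}u| .$$ -/

import Mathlib

open Set

noncomputable section

namespace FDBellman

/-- `ℝ^d` with the Euclidean norm. -/
abbrev Space (d : ℕ) : Type := EuclideanSpace ℝ (Fin d)

/-- The indices `±1, …, ±d₁`: a number in `Fin d₁` together with a sign in `ℤˣ = {1, -1}`. -/
abbrev Idx (d₁ : ℕ) : Type := Fin d₁ × ℤˣ

/-- The index `-k`. -/
def Idx.opp {d₁ : ℕ} (k : Idx d₁) : Idx d₁ := (k.1, -k.2)

/-- First difference `δ_{η,l} φ(x) = (φ(x + η l) - φ(x)) / η`. -/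
def fd {d : ℕ} (η : ℝ) (l : Space d) (φ : Space d → ℝ) (x : Space d) : ℝ :=
  (φ (x + η • l) - φ x) / η

/-- Pure second difference `Δ_{η,l} φ(x) = (φ(x + η l) - 2 φ(x) + φ(x - η l)) / η²`. -/
def sd {d : ℕ} (η : ℝ) (l : Space d) (φ : Space d → ℝ) (x : Space d) : ℝ :=
  (φ (x + η • l) - 2 * φ x + φ (x - η • l)) / η ^ 2

/-- The truncated time step `τ_T(t) = τ ∧ (T - t)⁺`. -/
def tauT (T τ t : ℝ) : ℝ := min τ (max (T - t) 0)

/-- The time difference `δ^T_τ u(t,x) = (u(t + τ_T(t), x) - u(t,x)) / τ`. -/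
def td {d : ℕ} (T τ : ℝ) (u : ℝ → Space d → ℝ) (t : ℝ) (x : Space d) : ℝ :=
  (u (t + tauT T τ t) x - u t x) / τ

/-- The data of the equation: direction vectors `ℓ_k`, coefficients `r, a_k, b_k, c`
and a free term `f` that depends on `(α, t, x)` only. -/
structure Data (A : Type*) (d d₁ : ℕ) where
  ell : Idx d₁ → Space d
  r : A → ℝ → ℝ
  a : A → Idx d₁ → ℝ → Space d → ℝ
  b : A → Idx d₁ → ℝ → Space d → ℝ
  c : A → ℝ → Space d → ℝ
  f : A → ℝ → Space d → ℝ

section Assumptions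

variable {A : Type*} {d d₁ : ℕ} (D : Data A d d₁)

/-- Continuity in `α`, Lipschitz continuity of `b` (constant `K₀`) and `c` (constant `K₃`) in `x`,
symmetry of the directions and of `a`, size of the directions, signs of `r` and `a`. -/
structure Basic [TopologicalSpace A] (K₀ K₃ : ℝ) : Prop where
  cont_r : ∀ t, Continuous fun α => D.r α t
  cont_a : ∀ k t x, Continuous fun α => D.a α k t x
  cont_b : ∀ k t x, Continuous fun α => D.b α k t x
  cont_c : ∀ t x, Continuous fun α => D.c α t x
  lip_b : ∀ α k t x y, |D.b α k t x - D.b α k t y| ≤ K₀ * ‖x - y‖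
  lip_c : ∀ α t x y, |D.c α t x - D.c α t y| ≤ K₃ * ‖x - y‖
  ell_opp : ∀ k, D.ell k.opp = -D.ell k
  a_opp : ∀ α k t x, D.a α k.opp t x = D.a α k t x
  ell_le : ∀ k, ‖D.ell k‖ ≤ K₀
  r_nonneg : ∀ α t, 0 ≤ D.r α t
  a_nonneg : ∀ α k t x, 0 ≤ D.a α k t x

/-- `|δ_{ρ,e} a_k| ≤ K₀ (√a_k + ρ)` for every unit vector `e` and every `ρ > 0`. -/
def RootLipschitz (K₀ : ℝ) : Prop :=
  ∀ α k t x (e : Space d) (ρ : ℝ), ‖e‖ = 1 → 0 < ρ →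
    |fd ρ e (D.a α k t) x| ≤ K₀ * (√(D.a α k t x) + ρ)

/-- `a_k ≥ h₀ (b_k)⁻`. -/
def Monotone (h₀ : ℝ) : Prop :=
  ∀ α k t x, h₀ * max (-D.b α k t x) 0 ≤ D.a α k t x

/-- The list of pairs (mesh size, direction): `(h, ℓ_k)` for `|k| ≤ d₁`, and `(η, l)`, `(η, -l)`. -/
def steps (h η : ℝ) (l : Space d) : Set (ℝ × Space d) :=
  range (fun k => (h, D.ell k)) ∪ {(η, l), (η, -l)}

/-- Bounds for the first differences of `f` and the second differences of `a, b, c, f` along all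
the steps. -/
structure SecondDiffs (h η : ℝ) (l : Space d) (K₀ K₃ : ℝ) : Prop where
  b_le : ∀ p ∈ steps D h η l, ∀ q ∈ steps D h η l, ∀ α k t x,
    |fd q.1 q.2 (fd p.1 p.2 (D.b α k t)) x| ≤ K₃
  c_le : ∀ p ∈ steps D h η l, ∀ q ∈ steps D h η l, ∀ α t x,
    |fd q.1 q.2 (fd p.1 p.2 (D.c α t)) x| ≤ K₃
  f_le : ∀ p ∈ steps D h η l, ∀ q ∈ steps D h η l, ∀ α t x,
    |fd q.1 q.2 (fd p.1 p.2 (D.f α t)) x| ≤ K₃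
  f_first_le : ∀ p ∈ steps D h η l, ∀ α t x, |fd p.1 p.2 (D.f α t) x| ≤ K₃
  a_le : ∀ p ∈ steps D h η l, ∀ q ∈ steps D h η l, ∀ α k t x,
    |fd q.1 q.2 (fd p.1 p.2 (D.a α k t)) x| ≤ K₀ + K₃ * √(D.a α k t x)

/-- `δ ≤ sup_α a_k ≤ K₀` and `r, |b_k|, |c|, |f| ≤ K₃`. -/
structure Nondegenerate (δ K₀ K₃ : ℝ) : Prop where
  le_sup_a : ∀ k t x, δ ≤ ⨆ α, D.a α k t x
  a_le : ∀ α k t x, D.a α k t x ≤ K₀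
  r_le : ∀ α t, D.r α t ≤ K₃
  b_le : ∀ α k t x, |D.b α k t x| ≤ K₃
  c_le : ∀ α t x, |D.c α t x| ≤ K₃
  f_le : ∀ α t x, |D.f α t x| ≤ K₃

/-- The short directions `ℓ_{±1}, …, ℓ_{±d₀}`. -/
def short (d₀ : ℕ) : Set (Space d) := D.ell '' {k | (k.1 : ℕ) < d₀}

/-- For some `1 ≤ d₀ < d₁`, every long direction `ℓ_k`, `d₀ < |k| ≤ d₁`, is the sum of two short
ones that are neither equal nor opposite, and every such sum of two short directions is
one of the vectors `ℓ_k`, `|k| ≤ d₁`. -/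
def GridStructure : Prop :=
  ∃ d₀ : ℕ, 1 ≤ d₀ ∧ d₀ < d₁ ∧
    (∀ k : Idx d₁, d₀ ≤ (k.1 : ℕ) →
      ∃ l₁ ∈ short D d₀, ∃ l₂ ∈ short D d₀, l₁ ≠ l₂ ∧ l₁ ≠ -l₂ ∧ D.ell k = l₁ + l₂) ∧
    (∀ l₁ ∈ short D d₀, ∀ l₂ ∈ short D d₀, l₁ ≠ l₂ → l₁ ≠ -l₂ → l₁ + l₂ ∈ range D.ell)

end Assumptions

section Grid

variable {A : Type*} {d d₁ : ℕ} (D : Data A d d₁)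

/-- `Λ₀ = {h ℓ_k}`. -/
def Lam₀ (h : ℝ) : Set (Space d) := range fun k => h • D.ell k

/-- `Λ = Λ₀ ∪ {η l, -η l}`. -/
def Lam (h η : ℝ) (l : Space d) : Set (Space d) := (fun p => p.1 • p.2) '' steps D h η l

/-- `Λ_∞`: all sums of `n ≥ 1` elements of `Λ`. -/
def LamInf (h η : ℝ) (l : Space d) : Set (Space d) :=
  {x | ∃ n : ℕ, 1 ≤ n ∧ ∃ s : Fin n → Space d, (∀ i, s i ∈ Lam D h η l) ∧ x = ∑ i, s i}

/-- `M̄_T = {(nτ) ∧ T : n = 0, 1, …} × Λ_∞`. -/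
def gridBar (T τ h η : ℝ) (l : Space d) : Set (ℝ × Space d) :=
  range (fun n : ℕ => min (n * τ) T) ×ˢ LamInf D h η l

/-- `M_T`: the part of `M̄_T` with `0 ≤ t < T`. -/
def grid (T τ h η : ℝ) (l : Space d) : Set (ℝ × Space d) :=
  gridBar D T τ h η l ∩ (Ico 0 T ×ˢ univ)

/-- `Q̄ = Q ∪ {(t + τ_T(t), x) : (t,x) ∈ Q, t + τ_T(t) = T}`. -/
def barQ (T τ : ℝ) (Q : Set (ℝ × Space d)) : Set (ℝ × Space d) :=
  Q ∪ {z | ∃ y ∈ Q, y.1 + tauT T τ y.1 = T ∧ z = (y.1 + tauT T τ y.1, y.2)}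

/-- `Q₂ᵒ = {(t,x) ∈ Q : t < T, (t + τ_T(t), x) ∈ Q̄, (t, x + Λ₀ + Λ₀) ⊂ Q}`. -/
def interior₂ (T τ h : ℝ) (Q : Set (ℝ × Space d)) : Set (ℝ × Space d) :=
  {z | z ∈ Q ∧ z.1 < T ∧ (z.1 + tauT T τ z.1, z.2) ∈ barQ T τ Q ∧
    ∀ y ∈ Lam₀ D h, ∀ y' ∈ Lam₀ D h, (z.1, z.2 + y + y') ∈ Q}

/-- `∂₂Q = Q̄ \ Q₂ᵒ`. -/
def boundary₂ (T τ h : ℝ) (Q : Set (ℝ × Space d)) : Set (ℝ × Space d) :=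
  barQ T τ Q \ interior₂ D T τ h Q

/-- `T'`: the least `nτ`, `n = 1, 2, …`, with `nτ ≥ T`. -/
def Tprime (T τ : ℝ) : ℝ := (sInf {n : ℕ | 1 ≤ n ∧ T ≤ n * τ} : ℕ) * τ

open Classical in
/-- `ξ(t) = e^{mt}` for `t < T` and `ξ(T) = e^{mT'}`. -/
def xi (m T τ t : ℝ) : ℝ :=
  if t < T then Real.exp (m * t) else Real.exp (m * Tprime T τ)

/-- `ξ₍₋₎ = ξ ∧ 1`. -/
def xiMinus (m T τ t : ℝ) : ℝ := min (xi m T τ t) 1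

/-- `c_m = (1 - e^{-mτ}) / τ`. -/
def cm (m τ : ℝ) : ℝ := (1 - Real.exp (-m * τ)) / τ

/-- `λ = inf_{α,t,x} [c(t,x) + r(t) c_m]`. -/
def lam (m τ : ℝ) : ℝ :=
  ⨅ p : A × ℝ × Space d, (D.c p.1 p.2.1 p.2.2 + D.r p.1 p.2.1 * cm m τ)

/-- `u` satisfies `sup_α [r δ^T_τ u + a_k Δ_{h,ℓ_k} u + b_k δ_{h,ℓ_k} u - c u + f] = 0` at `(t,x)`. -/
def SolvesAt (T τ h : ℝ) (u : ℝ → Space d → ℝ) (t : ℝ) (x : Space d) : Prop :=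
  IsLUB (range fun α =>
    D.r α t * td T τ u t x
      + ∑ k, (D.a α k t x * sd h (D.ell k) (u t) x + D.b α k t x * fd h (D.ell k) (u t) x)
      - D.c α t x * u t x + D.f α t x) 0

/-- Maximum of a non-negative function over a finite set (`0` if the set is empty). -/
def maxOn {X : Type*} (S : Set X) (g : X → ℝ) : ℝ := sSup (g '' S)

/-- The quantity `R` of the second-difference estimate. -/
def R (m T τ h : ℝ) (Q : Set (ℝ × Space d)) (u : ℝ → Space d → ℝ) : ℝ :=
  1 + maxOn (barQ T τ Q) (fun z => |xiMinus m T τ z.1 * u z.1 z.2|)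
    + maxOn Q (fun z => max (-(xiMinus m T τ z.1 * td T τ u z.1 z.2)) 0)
    + maxOn (boundary₂ D T τ h Q ×ˢ (univ : Set (Idx d₁ × Idx d₁))) (fun w =>
        |xiMinus m T τ w.1.1 * fd h (D.ell w.2.1) (fd h (D.ell w.2.2) (u w.1.1)) w.1.2|)
    + maxOn (barQ T τ Q ×ˢ (univ : Set (Idx d₁))) (fun w =>
        |xiMinus m T τ w.1.1 * fd h (D.ell w.2) (u w.1.1) w.1.2|)

end Grid

end FDBellman

end

open Set

noncomputable section

namespace FDBellman

/-! ### Difference operators and identities for zero-sum quadruples of directions. -/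

section Algebra

variable {d : ℕ} {h : ℝ}

/-! This is a Bernstein argument adapted to a supremum equation on a grid. Near-optimality of one
`α` at a point makes the frozen operator almost zero there, while it is nonpositive at every
neighbour. So only differences that take the neighbours with positive weight and the centre with
negative weight inherit a one-sided inequality. The unknowns are therefore `z_σ = lap h (tetra σ) (ξ
u)`, sums of four increments along steps adding up to zero. They include the pure second
differences, and with them they recover the mixed differences whose two steps sum to a direction.

Let `-M` be the least value of all `z_σ` on `barQ`. The equation bounds each `a_k Δ_k` above by a
multiple of `M`, and the nondegeneracy of `sup a_k` turns this into a bound for `Δ_k`. Since `z_σ +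
z_{-σ}` is a sum of four pure second differences, `|z_σ| ≤ κ = cRatio * M` (`Problem.abs_lap_le`),
and a telescoping argument bounds all mixed differences by `12 κ` (`Problem.abs_mixed_le`).

If `M` were large compared with the data, take a maximum over points and `π` of `bern`, that is
`-z_π + p ∑ (κ - z_σ)² + q ∑ (B - δ_j(ξ u))²`. As `κ - z_σ` and `B - δ_j(ξ u)` are nonnegative,
one-sided inequalities suffice to differentiate the squares. The squares produce quadratic terms
`goodSecond` and `goodFirst` that must absorb the errors of the product rule. The delicate error is
`√a_k |δ_y Δ_k (ξ u)|`: the quadratic terms control, with weight `a_k`, only differences in the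
directions `±k`. The identity `sd_shift_sub` rewrites this third difference through such differences
of quadruples, provided `k` splits suitably relative to `y`. That combinatorial fact is
`Splits.exists_split`.

The remaining errors are a multiple of `M` depending on `δ, d₁, K₀` only, because `K₃` occurs either
next to `B`, which is small relative to `M`, or in a term absorbed by `goodFirst`. A large `λ` then
contradicts the maximum (`CoefBounds.not_max_bern`). For `h` above `min h₀ 1` the second difference
is just a first difference divided by `h`. -/

/-- The points of a zero-sum quadruple determined by a triple `(a, b, s)`. -/
def tetra (σ : Space d × Space d × Space d) : Fin 4 → Space d :=
  ![σ.1, σ.2.2 - σ.1, σ.2.1, -(σ.2.2 + σ.2.1)]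

/-- The second difference `h⁻² ∑ (φ(x + h Pₙ) - φ(x))`. -/
def lap (h : ℝ) (P : Fin 4 → Space d) (φ : Space d → ℝ) (x : Space d) : ℝ :=
  (∑ n, (φ (x + h • P n) - φ x)) / h ^ 2

theorem lap_mul (P : Fin 4 → Space d) (φ ψ : Space d → ℝ) (x : Space d) :
    lap h P (fun y => φ y * ψ y) x = φ x * lap h P ψ x + ψ x * lap h P φ x
      + (∑ n, (φ (x + h • P n) - φ x) * (ψ (x + h • P n) - ψ x)) / h ^ 2 := by
  simp only [lap, Fin.sum_univ_four]
  ring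

theorem lap_sum {ι : Type*} (s : Finset ι) (P : Fin 4 → Space d) (φ : ι → Space d → ℝ)
    (x : Space d) :
    lap h P (fun y => ∑ i ∈ s, φ i y) x = ∑ i ∈ s, lap h P (φ i) x := by
  simp only [lap, ← Finset.sum_sub_distrib, ← Finset.sum_div]
  rw [Finset.sum_comm]

theorem lap_add (P : Fin 4 → Space d) (φ ψ : Space d → ℝ) (x : Space d) :
    lap h P (fun y => φ y + ψ y) x = lap h P φ x + lap h P ψ x := by
  simp only [lap, Fin.sum_univ_four]
  ring

theorem lap_sub (P : Fin 4 → Space d) (φ ψ : Space d → ℝ) (x : Space d) :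
    lap h P (fun y => φ y - ψ y) x = lap h P φ x - lap h P ψ x := by
  simp only [lap, Fin.sum_univ_four]
  ring

theorem lap_const_mul (P : Fin 4 → Space d) (s : ℝ) (φ : Space d → ℝ) (x : Space d) :
    lap h P (fun y => s * φ y) x = s * lap h P φ x := by
  simp only [lap, Fin.sum_univ_four]
  ring

theorem lap_fd (P : Fin 4 → Space d) (l : Space d) (φ : Space d → ℝ) (x : Space d) :
    lap h P (fd h l φ) x = fd h l (lap h P φ) x := by
  have e : ∀ n, x + h • P n + h • l = x + h • l + h • P n := fun n => by abel
  simp only [lap, fd, Fin.sum_univ_four, e]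
  ring

theorem lap_sd (P : Fin 4 → Space d) (l : Space d) (φ : Space d → ℝ) (x : Space d) :
    lap h P (sd h l φ) x = sd h l (lap h P φ) x := by
  have e : ∀ n, x + h • P n + h • l = x + h • l + h • P n := fun n => by abel
  have e' : ∀ n, x + h • P n - h • l = x - h • l + h • P n := fun n => by abel
  simp only [lap, sd, Fin.sum_univ_four, e, e']
  ring

theorem fd_comm (l l' : Space d) (φ : Space d → ℝ) (x : Space d) :
    fd h l (fd h l' φ) x = fd h l' (fd h l φ) x := by
  have e : x + h • l + h • l' = x + h • l' + h • l := by abel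
  simp only [fd, e]
  ring

theorem fd_sum {ι : Type*} (s : Finset ι) (l : Space d) (φ : ι → Space d → ℝ) (x : Space d) :
    fd h l (fun y => ∑ i ∈ s, φ i y) x = ∑ i ∈ s, fd h l (φ i) x := by
  simp only [fd, ← Finset.sum_sub_distrib, ← Finset.sum_div]

theorem fd_sd (l l' : Space d) (φ : Space d → ℝ) (x : Space d) :
    fd h l (sd h l' φ) x = sd h l' (fd h l φ) x := by
  have e : x + h • l + h • l' = x + h • l' + h • l := by abel
  have e' : x + h • l - h • l' = x - h • l' + h • l := by abel
  simp only [fd, sd, e, e']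
  ring

theorem fd_zero (φ : Space d → ℝ) (x : Space d) : fd h 0 φ x = 0 := by
  simp [fd]

theorem sd_zero (φ : Space d → ℝ) (x : Space d) : sd h 0 φ x = 0 := by
  simp only [sd, smul_zero, add_zero, sub_zero]
  ring

theorem sd_eq_neg_fd_fd (l : Space d) (φ : Space d → ℝ) (x : Space d) :
    sd h l φ x = -fd h l (fd h (-l) φ) x := by
  have e : x + h • l + h • (-l) = x := by module
  have e' : x + h • (-l) = x - h • l := by module
  simp only [sd, fd, e, e']
  ring

theorem fd_fd_self (l : Space d) (φ : Space d → ℝ) (x : Space d) :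
    fd h l (fd h l φ) x = sd h l φ (x + h • l) := by
  have e : x + h • l - h • l = x := by module
  simp only [sd, fd, e]
  ring

theorem fd_add_dir (l₁ l₂ : Space d) (φ : Space d → ℝ) (x : Space d) :
    fd h (l₁ + l₂) φ x = fd h l₁ φ (x + h • l₂) + fd h l₂ φ x := by
  have e : x + h • (l₁ + l₂) = x + h • l₂ + h • l₁ := by module
  simp only [fd, e]
  ring

/-- A zero-sum quadruple splits into three mixed differences along `(a, s - a)`, `(b, -(s + b))` and
`(s, -s)`. This is why `triples` asks `s` to be a direction: bounds for mixed differences transfer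
to quadruples with a factor `3`. -/
theorem lap_tetra (a b s : Space d) (φ : Space d → ℝ) (x : Space d) :
    lap h (tetra (a, b, s)) φ x = -(fd h a (fd h (s - a) φ) x
      + fd h b (fd h (-(s + b)) φ) x + fd h s (fd h (-s) φ) x) := by
  have e₁ : x + h • a + h • (s - a) = x + h • s := by module
  have e₂ : x + h • b + h • (-(s + b)) = x + h • (-s) := by module
  have e₃ : x + h • s + h • (-s) = x := by module
  simp only [lap, tetra, fd, Fin.sum_univ_four, e₁, e₂, e₃, Matrix.cons_val]
  ring

theorem lap_pure (k : Space d) (φ : Space d → ℝ) (x : Space d) :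
    lap h (tetra (k, 0, 0)) φ x = sd h k φ x := by
  have e : x + h • -k = x - h • k := by module
  simp only [lap, tetra, sd, Fin.sum_univ_four, Matrix.cons_val, zero_sub, e]
  simp only [add_zero, neg_zero, smul_zero]
  ring

/-- Symmetrising a quadruple leaves pure second differences only, so upper bounds for these and
lower bounds for all quadruples give upper bounds for all quadruples. -/
theorem lap_add_lap_neg (a b s : Space d) (φ : Space d → ℝ) (x : Space d) :
    lap h (tetra (a, b, s)) φ x + lap h (tetra (-a, -b, -s)) φ x
      = sd h a φ x + sd h (s - a) φ x + sd h b φ x + sd h (s + b) φ x := by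
  have e₁ : x + h • -a = x - h • a := by module
  have e₂ : x + h • (-s - -a) = x - h • (s - a) := by module
  have e₃ : x + h • -b = x - h • b := by module
  have e₄ : x + h • (-(-s + -b)) = x + h • (s + b) := by module
  have e₅ : x + h • (-(s + b)) = x - h • (s + b) := by module
  simp only [lap, tetra, sd, Fin.sum_univ_four, Matrix.cons_val, e₁, e₂, e₃, e₄, e₅]
  ring

/-- The quadruple here is `-i, -j, 0, i + j`; hence only pairs whose sum is again a direction are
reached. -/
theorem fd_fd_eq_lap (i j : Space d) (φ : Space d → ℝ) (x : Space d) :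
    fd h i (fd h j φ) x = lap h (tetra (-i, 0, -(i + j))) φ x - sd h i φ x - sd h j φ x := by
  have e₁ : x + h • -i = x - h • i := by module
  have e₂ : x + h • (-(i + j) - -i) = x - h • j := by module
  have e₄ : x + h • (-(-(i + j) + 0)) = x + h • i + h • j := by module
  have e₅ : x + h • (0 : Space d) = x := by module
  simp only [lap, tetra, sd, fd, Fin.sum_univ_four, Matrix.cons_val, e₁, e₂, e₄, e₅]
  ring

/-- The third difference `δ_y Δ_k` as a combination of differences in the directions `±k` of
zero-sum second differences. -/
theorem sd_shift_sub {y k q q' : Space d} (hq : q + q' = k) (φ : Space d → ℝ) (x : Space d) :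
    sd h k φ (x + h • y) - sd h k φ x =
      (lap h (tetra (-k, y, -q')) φ (x + h • k) - lap h (tetra (-k, y, -q')) φ x)
      - (sd h q φ (x + h • k) - sd h q φ x)
      - (sd h (y - q') φ (x + h • k) - sd h (y - q') φ x)
      + (lap h (tetra (k, y, q)) φ (x + h • -k) - lap h (tetra (k, y, q)) φ x)
      - (sd h q' φ (x + h • -k) - sd h q' φ x)
      - (sd h (y + q) φ (x + h • -k) - sd h (y + q) φ x) := by
  -- Both quadruples contain `y`. Shifting them by `k` and by `-k` yields the values at `x + h(y ±
  -- k)` that form the second difference at the shifted point; the surplus values cancel against the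
  -- pure second differences because `q + q' = k`.
  subst hq
  simp only [lap, tetra, sd, Fin.sum_univ_four, Matrix.cons_val, smul_add, smul_sub, smul_neg]
  generalize h • y = Y
  generalize h • q = A
  generalize h • q' = B
  have e : ∀ p q : Space d, p - q = p + -q := sub_eq_add_neg
  simp only [e, neg_add_rev, neg_neg]
  abel_nf
  ring

end Algebra

/-! ### Combinatorics of the set of directions. -/

section Directions

variable {A : Type*} {d d₁ : ℕ} {D : Data A d d₁} {d₀ : ℕ}

open Classical in
/-- The directions `ℓ_k` together with `0`. -/
def dirs (ell : Idx d₁ → Space d) : Finset (Space d) := insert 0 (Finset.univ.image ell)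

open Classical in
/-- The triples `(a, b, s)` whose zero-sum quadruple consists of directions. -/
def triples (ell : Idx d₁ → Space d) : Finset (Space d × Space d × Space d) :=
  (dirs ell ×ˢ dirs ell ×ˢ dirs ell).filter
    fun σ => σ.2.2 - σ.1 ∈ dirs ell ∧ σ.2.2 + σ.2.1 ∈ dirs ell

variable {ell : Idx d₁ → Space d}

theorem zero_mem_dirs : (0 : Space d) ∈ dirs ell := by simp [dirs]

theorem ell_mem_dirs (k : Idx d₁) : ell k ∈ dirs ell := by simp [dirs]

theorem mem_dirs {y : Space d} : y ∈ dirs ell ↔ y = 0 ∨ ∃ k, ell k = y := by simp [dirs]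

theorem Idx.opp_opp (k : Idx d₁) : k.opp.opp = k := by simp [Idx.opp]

theorem neg_mem_dirs (hopp : ∀ k, ell k.opp = -ell k) {y : Space d} (hy : y ∈ dirs ell) :
    -y ∈ dirs ell := by
  rcases mem_dirs.1 hy with rfl | ⟨k, rfl⟩
  · simpa using hy
  · rw [← hopp]
    exact ell_mem_dirs _

theorem norm_le_of_mem_dirs {K₀ : ℝ} (hK₀ : 0 ≤ K₀) (hell : ∀ k, ‖ell k‖ ≤ K₀) {y : Space d}
    (hy : y ∈ dirs ell) : ‖y‖ ≤ K₀ := by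
  rcases mem_dirs.1 hy with rfl | ⟨k, rfl⟩
  · simpa using hK₀
  · exact hell k

theorem mem_triples {a b s : Space d} : (a, b, s) ∈ triples ell ↔
    a ∈ dirs ell ∧ b ∈ dirs ell ∧ s ∈ dirs ell ∧ s - a ∈ dirs ell ∧ s + b ∈ dirs ell := by
  simp [triples, and_assoc]

theorem tetra_mem_dirs (hopp : ∀ k, ell k.opp = -ell k) {σ : Space d × Space d × Space d}
    (hσ : σ ∈ triples ell) (n : Fin 4) : tetra σ n ∈ dirs ell := by
  obtain ⟨a, b, s⟩ := σ
  obtain ⟨h1, h2, h3, h4, h5⟩ := mem_triples.1 hσ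
  fin_cases n
  · exact h1
  · exact h4
  · exact h2
  · exact neg_mem_dirs hopp h5

theorem pure_mem_triples (hopp : ∀ k, ell k.opp = -ell k) {k : Space d} (hk : k ∈ dirs ell) :
    (k, 0, 0) ∈ triples ell := by
  rw [mem_triples]
  simp [hk, zero_mem_dirs, neg_mem_dirs hopp hk]

theorem neg_mem_triples (hopp : ∀ k, ell k.opp = -ell k) {a b s : Space d}
    (hσ : (a, b, s) ∈ triples ell) : (-a, -b, -s) ∈ triples ell := by
  obtain ⟨h1, h2, h3, h4, h5⟩ := mem_triples.1 hσ
  refine mem_triples.2 ⟨neg_mem_dirs hopp h1, neg_mem_dirs hopp h2, neg_mem_dirs hopp h3, ?_, ?_⟩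
  · have := neg_mem_dirs hopp h4
    rwa [show -s - -a = -(s - a) by abel]
  · have := neg_mem_dirs hopp h5
    rwa [show -s + -b = -(s + b) by abel]

theorem mixed_mem_triples (hopp : ∀ k, ell k.opp = -ell k) {i j : Space d} (hi : i ∈ dirs ell)
    (hj : j ∈ dirs ell) (hij : i + j ∈ dirs ell) : (-i, 0, -(i + j)) ∈ triples ell := by
  have h := neg_mem_dirs hopp hij
  refine mem_triples.2 ⟨neg_mem_dirs hopp hi, zero_mem_dirs, h, ?_, by simpa using h⟩
  rw [show -(i + j) - -i = -j by abel]
  exact neg_mem_dirs hopp hj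

theorem card_dirs_le : (dirs ell).card ≤ 2 * d₁ + 1 := by
  classical
  refine (Finset.card_insert_le _ _).trans ?_
  have : (Finset.univ.image ell).card ≤ d₁ * 2 :=
    Finset.card_image_le.trans (by simp [Idx, Finset.card_univ])
  omega

theorem card_triples_le : (triples ell).card ≤ (2 * d₁ + 1) ^ 3 := by
  classical
  refine (Finset.card_filter_le _ _).trans ?_
  rw [Finset.card_product, Finset.card_product]
  have := card_dirs_le (ell := ell)
  calc _ ≤ (2 * d₁ + 1) * ((2 * d₁ + 1) * (2 * d₁ + 1)) := by gcongr
    _ = _ := by ring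

/-- Every direction is short or the sum of two short ones which are neither equal nor opposite. -/
def Splits (D : Data A d d₁) (d₀ : ℕ) : Prop :=
  1 ≤ d₀ ∧ d₀ < d₁ ∧
    (∀ k : Idx d₁, d₀ ≤ (k.1 : ℕ) →
      ∃ l₁ ∈ short D d₀, ∃ l₂ ∈ short D d₀, l₁ ≠ l₂ ∧ l₁ ≠ -l₂ ∧ D.ell k = l₁ + l₂) ∧
    (∀ l₁ ∈ short D d₀, ∀ l₂ ∈ short D d₀, l₁ ≠ l₂ → l₁ ≠ -l₂ → l₁ + l₂ ∈ range D.ell)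

theorem short_mem_dirs {y : Space d} (hy : y ∈ short D d₀) : y ∈ dirs D.ell := by
  obtain ⟨k, -, rfl⟩ := hy
  exact ell_mem_dirs k

theorem neg_mem_short (hopp : ∀ k, D.ell k.opp = -D.ell k) {y : Space d} (hy : y ∈ short D d₀) :
    -y ∈ short D d₀ := by
  obtain ⟨k, hk, rfl⟩ := hy
  exact ⟨k.opp, hk, hopp k⟩

/-- The only sum of two short directions not guaranteed to be a direction is `y + y` with `y ≠ 0`;
opposite vectors give `0`, which `dirs` contains. -/
theorem Splits.add_mem (hS : Splits D d₀) {y z : Space d}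
    (hy : y ∈ short D d₀) (hz : z ∈ short D d₀) (hyz : y ≠ z ∨ y = 0) : y + z ∈ dirs D.ell := by
  by_cases h0 : y = 0
  · subst h0
    simpa using short_mem_dirs hz
  by_cases h1 : y = -z
  · subst h1
    simp [zero_mem_dirs]
  · obtain ⟨k, hk⟩ := hS.2.2.2 y hy z hz (hyz.resolve_right h0) h1
    rw [← hk]
    exact ell_mem_dirs k

theorem Splits.cases (hS : Splits D d₀) (k : Idx d₁) :
    D.ell k ∈ short D d₀ ∨
      ∃ l₁ ∈ short D d₀, ∃ l₂ ∈ short D d₀, l₁ ≠ l₂ ∧ l₁ ≠ -l₂ ∧ D.ell k = l₁ + l₂ := by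
  by_cases hk : (k.1 : ℕ) < d₀
  · exact Or.inl ⟨k, hk, rfl⟩
  · exact Or.inr (hS.2.2.1 k (by omega))

theorem eq_zero_of_eq_neg {v : Space d} (hv : v = -v) : v = 0 := by
  have h2 : (2 : ℝ) • v = 0 := by
    rw [two_smul]
    nth_rewrite 1 [hv]
    exact neg_add_cancel v
  exact (smul_eq_zero.1 h2).resolve_left two_ne_zero

/-- The case of `Splits.exists_split` in which one direction is short. -/
theorem Splits.exists_split_short (hS : Splits D d₀) (hopp : ∀ k, D.ell k.opp = -D.ell k)
    {y l₁ l₂ : Space d} (hy : y ∈ short D d₀) (h₁ : l₁ ∈ short D d₀) (h₂ : l₂ ∈ short D d₀)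
    (h12 : l₁ ≠ l₂) :
    (y + l₁ ∈ dirs D.ell ∧ y - l₂ ∈ dirs D.ell) ∨ (y + l₂ ∈ dirs D.ell ∧ y - l₁ ∈ dirs D.ell) := by
  have key : ∀ l ∈ short D d₀, ∀ l' ∈ short D d₀, ¬ (y + l ∈ dirs D.ell ∧ y - l' ∈ dirs D.ell) →
      y ≠ 0 ∧ (y = l ∨ y = -l') := by
    intro l hl l' hl' hn
    by_contra hc
    refine hn ⟨hS.add_mem hy hl (by tauto), ?_⟩
    rw [sub_eq_add_neg]
    exact hS.add_mem hy (neg_mem_short hopp hl') (by tauto)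
  by_contra hc
  rw [not_or] at hc
  obtain ⟨h0, c1⟩ := key l₁ h₁ l₂ h₂ hc.1
  obtain ⟨-, c2⟩ := key l₂ h₂ l₁ h₁ hc.2
  rcases c1 with c1 | c1 <;> rcases c2 with c2 | c2
  · exact h12 (c1.symm.trans c2)
  · exact h0 (eq_zero_of_eq_neg (c2.trans (by rw [c1])))
  · exact h0 (eq_zero_of_eq_neg (c1.trans (by rw [c2])))
  · exact h12 (neg_injective (c2.symm.trans c1))

/-- The conditions make `(-k, y, -q')` and `(k, y, q)` admissible triples. For short `y` or `k` an
explicit choice works, since a failure forces a coincidence between short vectors. When both are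
long, `y = m₁ + m₂` and `k = l₁ + l₂`, four choices compete: `q = l₁ - p` with `p` one of `m₁, m₂`,
and the plain splittings of `k` in either order. -/
theorem Splits.exists_split (hS : Splits D d₀) (hopp : ∀ k, D.ell k.opp = -D.ell k)
    {y k : Space d} (hy : y ∈ dirs D.ell) (hk : k ∈ dirs D.ell) :
    ∃ q ∈ dirs D.ell, ∃ q' ∈ dirs D.ell,
      q + q' = k ∧ y + q ∈ dirs D.ell ∧ y - q' ∈ dirs D.ell := by
  have hk0 := hk
  have hy0 := hy
  rcases mem_dirs.1 hk with rfl | ⟨k, rfl⟩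
  · exact ⟨0, hk, 0, hk, by simp, by simpa using hy, by simpa using hy⟩
  rcases mem_dirs.1 hy with rfl | ⟨y, rfl⟩
  · exact ⟨0, hy, D.ell k, hk, by simp, by simpa using hy, by
      simpa using neg_mem_dirs hopp hk⟩
  rcases hS.cases y with hys | ⟨m₁, hm₁, m₂, hm₂, hm, hm', hym⟩
  · rcases hS.cases k with hks | ⟨l₁, hl₁, l₂, hl₂, hl, hl', hkl⟩
    · by_cases he : D.ell y = -D.ell k
      · exact ⟨D.ell k, hk0, 0, zero_mem_dirs, by simp, by simp [he, zero_mem_dirs],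
          by simpa using hy0⟩
      · refine ⟨0, zero_mem_dirs, D.ell k, hk0, by simp, by simpa using hy0, ?_⟩
        rw [sub_eq_add_neg]
        exact hS.add_mem hys (neg_mem_short hopp hks) (Or.inl he)
    · rcases hS.exists_split_short hopp hys hl₁ hl₂ hl with h | h
      · exact ⟨l₁, short_mem_dirs hl₁, l₂, short_mem_dirs hl₂, hkl.symm, h⟩
      · exact ⟨l₂, short_mem_dirs hl₂, l₁, short_mem_dirs hl₁, by rw [hkl, add_comm], h⟩
  · rcases hS.cases k with hks | ⟨l₁, hl₁, l₂, hl₂, hl, hl', hkl⟩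
    · rcases hS.exists_split_short hopp hks hm₁ hm₂ hm with h | h
      · refine ⟨-m₂ + D.ell k, ?_, m₂, short_mem_dirs hm₂, by abel, ?_, ?_⟩
        · rw [show -m₂ + D.ell k = D.ell k - m₂ by abel]
          exact h.2
        · rw [hym, show m₁ + m₂ + (-m₂ + D.ell k) = D.ell k + m₁ by abel]
          exact h.1
        · rw [hym, add_sub_cancel_right]
          exact short_mem_dirs hm₁
      · refine ⟨-m₁ + D.ell k, ?_, m₁, short_mem_dirs hm₁, by abel, ?_, ?_⟩
        · rw [show -m₁ + D.ell k = D.ell k - m₁ by abel]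
          exact h.2
        · rw [hym, show m₁ + m₂ + (-m₁ + D.ell k) = D.ell k + m₂ by abel]
          exact h.1
        · rw [hym, add_sub_cancel_left]
          exact short_mem_dirs hm₂
    · have key : ∀ p₁ ∈ short D d₀, ∀ p₂ ∈ short D d₀, p₁ + p₂ = m₁ + m₂ →
          (l₁ - p₁ ∈ dirs D.ell ∧ l₂ + p₁ ∈ dirs D.ell ∧ p₂ + l₁ ∈ dirs D.ell
            ∧ p₂ - l₂ ∈ dirs D.ell) → _ := fun p₁ _ p₂ _ hp hc =>
        (⟨l₁ - p₁, hc.1, l₂ + p₁, hc.2.1, by rw [hkl]; abel,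
          by rw [hym, ← hp, show p₁ + p₂ + (l₁ - p₁) = p₂ + l₁ by abel]; exact hc.2.2.1,
          by rw [hym, ← hp, show p₁ + p₂ - (l₂ + p₁) = p₂ - l₂ by abel]; exact hc.2.2.2⟩ :
          ∃ q ∈ dirs D.ell, ∃ q' ∈ dirs D.ell, q + q' = D.ell k ∧ D.ell y + q ∈ dirs D.ell ∧
            D.ell y - q' ∈ dirs D.ell)
      -- Each failure of a membership is an equality between nonzero short vectors, so failure for
      -- both orders of `m₁, m₂` leaves sixteen pairs of equalities. Each contradicts distinctness,
      -- non-vanishing, or `y ≠ ±(l₁ - l₂)`.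
      have fails : ∀ p₁ ∈ short D d₀, ∀ p₂ ∈ short D d₀,
          ¬ (l₁ - p₁ ∈ dirs D.ell ∧ l₂ + p₁ ∈ dirs D.ell ∧ p₂ + l₁ ∈ dirs D.ell
            ∧ p₂ - l₂ ∈ dirs D.ell) →
          (l₁ = -p₁ ∧ l₁ ≠ 0) ∨ (l₂ = p₁ ∧ l₂ ≠ 0) ∨ (p₂ = l₁ ∧ p₂ ≠ 0)
            ∨ (p₂ = -l₂ ∧ p₂ ≠ 0) := by
        intro p₁ hp₁ p₂ hp₂ hn
        by_contra hc
        simp only [not_or, not_and_or, Ne, not_not] at hc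
        refine hn ⟨?_, hS.add_mem hl₂ hp₁ hc.2.1, hS.add_mem hp₂ hl₁ hc.2.2.1, ?_⟩
        · rw [sub_eq_add_neg]
          exact hS.add_mem hl₁ (neg_mem_short hopp hp₁) hc.1
        · rw [sub_eq_add_neg]
          exact hS.add_mem hp₂ (neg_mem_short hopp hl₂) hc.2.2.2
      have special : D.ell y = l₂ - l₁ → _ := fun he =>
        (⟨l₁, short_mem_dirs hl₁, l₂, short_mem_dirs hl₂, hkl.symm,
          by rw [he, sub_add_cancel]; exact short_mem_dirs hl₂,
          by rw [he, show l₂ - l₁ - l₂ = -l₁ by abel]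
             exact neg_mem_dirs hopp (short_mem_dirs hl₁)⟩ :
          ∃ q ∈ dirs D.ell, ∃ q' ∈ dirs D.ell, q + q' = D.ell k ∧ D.ell y + q ∈ dirs D.ell ∧
            D.ell y - q' ∈ dirs D.ell)
      have special' : D.ell y = l₁ - l₂ → _ := fun he =>
        (⟨l₂, short_mem_dirs hl₂, l₁, short_mem_dirs hl₁, by rw [hkl, add_comm],
          by rw [he, sub_add_cancel]; exact short_mem_dirs hl₁,
          by rw [he, show l₁ - l₂ - l₁ = -l₂ by abel]
             exact neg_mem_dirs hopp (short_mem_dirs hl₂)⟩ :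
          ∃ q ∈ dirs D.ell, ∃ q' ∈ dirs D.ell, q + q' = D.ell k ∧ D.ell y + q ∈ dirs D.ell ∧
            D.ell y - q' ∈ dirs D.ell)
      by_contra hcon
      have f₁ := fails m₁ hm₁ m₂ hm₂ fun hc => hcon (key m₁ hm₁ m₂ hm₂ rfl hc)
      have f₂ := fails m₂ hm₂ m₁ hm₁ fun hc => hcon (key m₂ hm₂ m₁ hm₁ (add_comm _ _) hc)
      have s₁ : m₁ + m₂ ≠ l₂ - l₁ := fun he => hcon (special (hym.trans he))
      have s₂ : m₁ + m₂ ≠ l₁ - l₂ := fun he => hcon (special' (hym.trans he))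
      clear hcon key fails special special'
      rcases f₁ with ⟨a, a0⟩ | ⟨a, a0⟩ | ⟨a, a0⟩ | ⟨a, a0⟩ <;>
      rcases f₂ with ⟨b, b0⟩ | ⟨b, b0⟩ | ⟨b, b0⟩ | ⟨b, b0⟩
      · exact hm (neg_injective (a.symm.trans b))
      · exact s₁ (by rw [a, b]; abel)
      · exact a0 (eq_zero_of_eq_neg (a.trans (by rw [b])))
      · exact hl (a.trans (by rw [b, neg_neg]))
      · exact s₁ (by rw [b, a]; abel)
      · exact hm (a.symm.trans b)
      · exact hl (b.symm.trans a.symm)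
      · exact a0 (eq_zero_of_eq_neg (a.trans b))
      · exact a0 (eq_zero_of_eq_neg (a.trans b))
      · exact hl (a.symm.trans b.symm)
      · exact hm (b.trans a.symm)
      · exact s₂ (by rw [a, b]; abel)
      · exact hl (b.trans (by rw [a, neg_neg]))
      · exact a0 (eq_zero_of_eq_neg (a.trans (by rw [b])))
      · exact s₂ (by rw [a, b]; abel)
      · exact hm (b.trans a.symm)

/-- Every direction is the sum of two directions from the list. -/
theorem Splits.exists_add (hS : Splits D d₀) (hopp : ∀ k, D.ell k.opp = -D.ell k)
    (k : Idx d₁) : ∃ i j, D.ell k = D.ell i + D.ell j := by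
  rcases hS.cases k with hks | ⟨l₁, ⟨i, -, rfl⟩, l₂, ⟨j, -, rfl⟩, -, -, hkl⟩
  -- Since `d₀ < d₁` a long direction exists and supplies two short vectors that are neither equal
  -- nor opposite. At least one of them, `l`, differs from `±ℓ_k`, and then `ℓ_k = (ℓ_k + l) +
  -- (-l)`.
  · obtain ⟨l₁, hl₁, l₂, hl₂, hl, hl', -⟩ :=
      hS.2.2.1 (⟨d₀, hS.2.1⟩, 1) le_rfl
    have key : ∀ l ∈ short D d₀, D.ell k ≠ l → D.ell k ≠ -l →
        ∃ i j, D.ell k = D.ell i + D.ell j := by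
      intro l hl h1 h2
      obtain ⟨i, hi⟩ := hS.2.2.2 _ hks l hl h1 h2
      obtain ⟨j, -, hj⟩ := neg_mem_short hopp hl
      exact ⟨i, j, by rw [hi, hj]; abel⟩
    by_cases h : D.ell k ≠ l₁ ∧ D.ell k ≠ -l₁
    · exact key l₁ hl₁ h.1 h.2
    · refine key l₂ hl₂ (fun e => ?_) fun e => ?_
      · rw [e] at h
        exact h ⟨fun e' => hl e'.symm, fun e' => hl' (by rw [e', neg_neg])⟩
      · rw [e] at h
        exact h ⟨fun e' => hl' e'.symm, fun e' => hl (neg_injective e').symm⟩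
  · exact ⟨i, j, hkl⟩

end Directions

/-! ### Coefficient bounds along grid steps. -/

section Coefficients

variable {d d₁ : ℕ} {ell : Idx d₁ → Space d}

/-- The bounds for the coefficients of one operator, at one time, on all translates by steps of
the grid. -/
structure CoefBounds (ell : Idx d₁ → Space d) (a b : Idx d₁ → Space d → ℝ) (c f : Space d → ℝ)
    (h K₀ K₃ : ℝ) : Prop where
  ell_opp : ∀ k, ell k.opp = -ell k
  a_opp : ∀ k x, a k.opp x = a k x
  a_nonneg : ∀ k x, 0 ≤ a k x
  a_le : ∀ k x, a k x ≤ K₀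
  weight : ∀ k x, 0 ≤ a k x + h * b k x
  a_shift : ∀ k x, ∀ y ∈ dirs ell, |a k (x + h • y) - a k x| ≤ K₀ ^ 2 * h * (√(a k x) + K₀ * h)
  b_shift : ∀ k x, ∀ y ∈ dirs ell, |b k (x + h • y) - b k x| ≤ K₀ ^ 2 * h
  c_shift : ∀ x, ∀ y ∈ dirs ell, |c (x + h • y) - c x| ≤ K₃ * K₀ * h
  f_shift : ∀ x, ∀ y ∈ dirs ell, |f (x + h • y) - f x| ≤ K₃ * h
  lap_a : ∀ k x, ∀ σ ∈ triples ell, |lap h (tetra σ) (a k) x| ≤ 3 * (K₀ + K₃ * √(a k x))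
  lap_b : ∀ k x, ∀ σ ∈ triples ell, |lap h (tetra σ) (b k) x| ≤ 3 * K₃
  lap_c : ∀ x, ∀ σ ∈ triples ell, |lap h (tetra σ) c x| ≤ 3 * K₃
  lap_f : ∀ x, ∀ σ ∈ triples ell, |lap h (tetra σ) f x| ≤ 3 * K₃

theorem abs_lap_tetra_le (hopp : ∀ k, ell k.opp = -ell k) {h B : ℝ}
    {ψ : Space d → ℝ} {x : Space d}
    (hψ : ∀ y ∈ dirs ell, ∀ z ∈ dirs ell, |fd h y (fd h z ψ) x| ≤ B)
    {σ : Space d × Space d × Space d} (hσ : σ ∈ triples ell) :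
    |lap h (tetra σ) ψ x| ≤ 3 * B := by
  obtain ⟨a, b, s⟩ := σ
  obtain ⟨h1, h2, h3, h4, h5⟩ := mem_triples.1 hσ
  rw [lap_tetra, abs_neg]
  have e1 := hψ _ h1 _ h4
  have e2 := hψ _ h2 _ (neg_mem_dirs hopp h5)
  have e3 := hψ _ h3 _ (neg_mem_dirs hopp h3)
  refine (abs_add_three _ _ _).trans ?_
  linarith

theorem abs_fd_fd_le_of_steps {h B : ℝ} {ψ : Space d → ℝ} {x : Space d} (hB : 0 ≤ B)
    (hψ : ∀ i j, |fd h (ell i) (fd h (ell j) ψ) x| ≤ B) :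
    ∀ y ∈ dirs ell, ∀ z ∈ dirs ell, |fd h y (fd h z ψ) x| ≤ B := by
  intro y hy z hz
  rcases mem_dirs.1 hy with rfl | ⟨i, rfl⟩
  · simpa [fd_zero] using hB
  rcases mem_dirs.1 hz with rfl | ⟨j, rfl⟩
  · rw [fd_comm, fd_zero]
    simpa using hB
  · exact hψ i j

/-- The hypothesis concerns unit vectors, so the step `h y` is read as a step of length `h ‖y‖`
along `y / ‖y‖`. -/
theorem abs_shift_le_of_rootLipschitz {K₀ h : ℝ} {φ : Space d → ℝ} {x y : Space d}
    (hK₀ : 0 ≤ K₀) (hh : 0 < h) (hy : ‖y‖ ≤ K₀)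
    (hφ : ∀ (e : Space d) (ρ : ℝ), ‖e‖ = 1 → 0 < ρ → |fd ρ e φ x| ≤ K₀ * (√(φ x) + ρ)) :
    |φ (x + h • y) - φ x| ≤ K₀ ^ 2 * h * (√(φ x) + K₀ * h) := by
  have hs := Real.sqrt_nonneg (φ x)
  by_cases h0 : y = 0
  · subst h0
    simp only [smul_zero, add_zero, sub_self, abs_zero]
    positivity
  have hn : 0 < ‖y‖ := norm_pos_iff.2 h0
  have hρ : 0 < h * ‖y‖ := mul_pos hh hn
  have key := hφ (‖y‖⁻¹ • y) (h * ‖y‖) (by rw [norm_smul, norm_inv, norm_norm,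
    inv_mul_cancel₀ hn.ne']) hρ
  have e : (h * ‖y‖) • (‖y‖⁻¹ • y) = h • y := by
    rw [smul_smul, mul_assoc, mul_inv_cancel₀ hn.ne', mul_one]
  rw [fd, e, abs_div, abs_of_pos hρ, div_le_iff₀ hρ] at key
  calc _ ≤ K₀ * (√(φ x) + h * ‖y‖) * (h * ‖y‖) := key
    _ ≤ K₀ * (√(φ x) + h * K₀) * (h * K₀) := by gcongr
    _ = _ := by ring

theorem Data.coefBounds {A : Type*} [TopologicalSpace A] {D : Data A d d₁}
    {K₀ K₃ h₀ h η : ℝ} {l : Space d} {δ : ℝ} (hK₀ : 0 ≤ K₀) (hK₃ : 0 ≤ K₃) (hh : 0 < h)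
    (hh₀ : h ≤ h₀)
    (hB : Basic D K₀ K₃) (hR : RootLipschitz D K₀) (hM : Monotone D h₀)
    (hS : SecondDiffs D h η l K₀ K₃) (hN : Nondegenerate D δ K₀ K₃) (α : A) (t : ℝ) :
    CoefBounds D.ell (fun k => D.a α k t) (fun k => D.b α k t) (D.c α t) (D.f α t) h K₀ K₃ := by
  have hnorm : ∀ y ∈ dirs D.ell, ‖y‖ ≤ K₀ := fun y => norm_le_of_mem_dirs hK₀ hB.ell_le
  have hst : ∀ k, (h, D.ell k) ∈ steps D h η l := fun k => Or.inl ⟨k, rfl⟩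
  have hlip : ∀ {K : ℝ} {φ : Space d → ℝ}, 0 ≤ K → (∀ x y, |φ x - φ y| ≤ K * ‖x - y‖) →
      ∀ x, ∀ y ∈ dirs D.ell, |φ (x + h • y) - φ x| ≤ K * K₀ * h := by
    intro K φ hK hφ x y hy
    refine (hφ _ _).trans ?_
    rw [add_sub_cancel_left, norm_smul, Real.norm_eq_abs, abs_of_pos hh, mul_assoc, mul_comm K₀]
    gcongr
    exact hnorm y hy
  refine ⟨hB.ell_opp, fun k x => hB.a_opp α k t x, fun k x => hB.a_nonneg α k t x,
    fun k x => hN.a_le α k t x, fun k x => ?_, fun k x y hy =>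
      abs_shift_le_of_rootLipschitz hK₀ hh (hnorm y hy) (fun e ρ he hρ => hR α k t x e ρ he hρ),
    fun k x y hy => ?_, hlip hK₃ (fun x y => hB.lip_c α t x y), fun x y hy => ?_, fun k x σ hσ => ?_,
    fun k x σ hσ => ?_, fun x σ hσ => ?_, fun x σ hσ => ?_⟩
  -- Here `h ≤ h₀` is decisive: `h b⁻ ≤ h₀ b⁻ ≤ a` makes the scheme monotone.
  · have h1 := hM α k t x
    have h2 := le_max_left (-D.b α k t x) 0
    have h3 := le_max_right (-D.b α k t x) 0
    nlinarith [mul_le_mul_of_nonneg_right hh₀ h3, mul_le_mul_of_nonneg_left h2 hh.le]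
  · rw [sq]
    exact hlip hK₀ (fun x y => hB.lip_b α k t x y) x y hy
  · rcases mem_dirs.1 hy with rfl | ⟨k, rfl⟩
    · simp only [smul_zero, add_zero, sub_self, abs_zero]
      positivity
    · have := hS.f_first_le _ (hst k) α t x
      rwa [fd, abs_div, abs_of_pos hh, div_le_iff₀ hh] at this
  · exact abs_lap_tetra_le hB.ell_opp (abs_fd_fd_le_of_steps (by positivity)
      fun i j => hS.a_le _ (hst j) _ (hst i) α k t x) hσ
  · exact abs_lap_tetra_le hB.ell_opp (abs_fd_fd_le_of_steps hK₃
      fun i j => hS.b_le _ (hst j) _ (hst i) α k t x) hσ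
  · exact abs_lap_tetra_le hB.ell_opp (abs_fd_fd_le_of_steps hK₃
      fun i j => hS.c_le _ (hst j) _ (hst i) α t x) hσ
  · exact abs_lap_tetra_le hB.ell_opp (abs_fd_fd_le_of_steps hK₃
      fun i j => hS.f_le _ (hst j) _ (hst i) α t x) hσ

end Coefficients

/-! ### The monotone scheme as a jump operator, and its product rules. -/

section Operator

variable {d d₁ : ℕ} {ell : Idx d₁ → Space d} {a b : Idx d₁ → Space d → ℝ} {c f : Space d → ℝ}
  {h K₀ K₃ : ℝ}

/-- The weight of the neighbour `x + h ℓ_k`. -/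
def rate (a b : Idx d₁ → Space d → ℝ) (h : ℝ) (x : Space d) (k : Idx d₁) : ℝ :=
  2 * a k x / h ^ 2 + b k x / h

/-- The second-order part of the operator, for a function `φ₀` at the present time, together with
the jump (of rate `ρ`) to a function `φ₁` at the next time. -/
def jump (ell : Idx d₁ → Space d) (a b : Idx d₁ → Space d → ℝ) (h ρ : ℝ)
    (φ₀ φ₁ : Space d → ℝ) (x : Space d) : ℝ :=
  ρ * (φ₁ x - φ₀ x) + ∑ k, rate a b h x k * (φ₀ (x + h • ell k) - φ₀ x)

/-- The complete operator with zeroth-order coefficient `c + ν` and free term `ζ f`. -/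
def oper (ell : Idx d₁ → Space d) (a b : Idx d₁ → Space d → ℝ) (c f : Space d → ℝ)
    (h ρ ν ζ : ℝ) (φ₀ φ₁ : Space d → ℝ) (x : Space d) : ℝ :=
  ρ * (φ₁ x - φ₀ x)
    + ∑ k, (a k x * sd h (ell k) φ₀ x + b k x * fd h (ell k) φ₀ x) - (c x + ν) * φ₀ x + ζ * f x

/-- The involution `k ↦ -k`. -/
def Idx.oppEquiv (d₁ : ℕ) : Idx d₁ ≃ Idx d₁ :=
  ⟨Idx.opp, Idx.opp, Idx.opp_opp, Idx.opp_opp⟩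

/-- The index set contains both `k` and `-k`, with equal `a`. Collecting the two contributions to a
neighbour gives the coefficient `2 a_k / h²` in `rate`. -/
theorem CoefBounds.sum_eq (hC : CoefBounds ell a b c f h K₀ K₃) (φ : Space d → ℝ) (x : Space d) :
    ∑ k, (a k x * sd h (ell k) φ x + b k x * fd h (ell k) φ x)
      = ∑ k, rate a b h x k * (φ (x + h • ell k) - φ x) := by
  have e : ∀ k, a k x * sd h (ell k) φ x = a k x / h ^ 2 * (φ (x + h • ell k) - φ x)
      + a k.opp x / h ^ 2 * (φ (x + h • ell k.opp) - φ x) := by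
    intro k
    have e' : x + h • -ell k = x - h • ell k := by module
    rw [hC.a_opp, hC.ell_opp, e', sd]
    ring
  have e₂ : ∑ k : Idx d₁, a k.opp x / h ^ 2 * (φ (x + h • ell k.opp) - φ x)
      = ∑ k : Idx d₁, a k x / h ^ 2 * (φ (x + h • ell k) - φ x) :=
    (Idx.oppEquiv d₁).sum_comp fun k => a k x / h ^ 2 * (φ (x + h • ell k) - φ x)
  simp only [e, Finset.sum_add_distrib, e₂]
  rw [← Finset.sum_add_distrib, ← Finset.sum_add_distrib]
  refine Finset.sum_congr rfl fun k _ => ?_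
  rw [rate, fd]
  ring

/-- Half of the second-order weight pays for a negative `b_k`; the other half remains available for
the quadratic terms. -/
theorem CoefBounds.le_rate (hC : CoefBounds ell a b c f h K₀ K₃) (hh : 0 < h) (x : Space d)
    (k : Idx d₁) : a k x / h ^ 2 ≤ rate a b h x k := by
  have e : rate a b h x k = a k x / h ^ 2 + (a k x + h * b k x) / h ^ 2 := by
    rw [rate]
    field_simp
    ring
  have := div_nonneg (hC.weight k x) (sq_nonneg h)
  linarith

theorem CoefBounds.rate_nonneg (hC : CoefBounds ell a b c f h K₀ K₃) (hh : 0 < h) (x : Space d)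
    (k : Idx d₁) : 0 ≤ rate a b h x k :=
  (div_nonneg (hC.a_nonneg k x) (sq_nonneg h)).trans (hC.le_rate hh x k)

/-- The quadratic term produced by the zero-sum second differences. -/
def goodSecond (ell : Idx d₁ → Space d) (a b : Idx d₁ → Space d → ℝ) (h : ℝ)
    (φ : Space d → ℝ) (x : Space d) : ℝ :=
  ∑ σ ∈ triples ell, ∑ k, rate a b h x k *
    (lap h (tetra σ) φ (x + h • ell k) - lap h (tetra σ) φ x) ^ 2

/-- The quadratic term produced by the first differences. -/
def goodFirst (ell : Idx d₁ → Space d) (a b : Idx d₁ → Space d → ℝ) (h : ℝ)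
    (φ : Space d → ℝ) (x : Space d) : ℝ :=
  ∑ j, ∑ k, rate a b h x k * (fd h (ell j) φ (x + h • ell k) - fd h (ell j) φ x) ^ 2

theorem CoefBounds.goodSecond_nonneg (hC : CoefBounds ell a b c f h K₀ K₃) (hh : 0 < h)
    (φ : Space d → ℝ) (x : Space d) : 0 ≤ goodSecond ell a b h φ x :=
  Finset.sum_nonneg fun _ _ => Finset.sum_nonneg fun k _ =>
    mul_nonneg (hC.rate_nonneg hh x k) (sq_nonneg _)

theorem CoefBounds.goodFirst_nonneg (hC : CoefBounds ell a b c f h K₀ K₃) (hh : 0 < h)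
    (φ : Space d → ℝ) (x : Space d) : 0 ≤ goodFirst ell a b h φ x :=
  Finset.sum_nonneg fun _ _ => Finset.sum_nonneg fun k _ =>
    mul_nonneg (hC.rate_nonneg hh x k) (sq_nonneg _)

theorem CoefBounds.le_goodSecond (hC : CoefBounds ell a b c f h K₀ K₃) (hh : 0 < h)
    (φ : Space d → ℝ) (x : Space d) (k : Idx d₁) {σ : Space d × Space d × Space d}
    (hσ : σ ∈ triples ell) :
    a k x / h ^ 2 * (lap h (tetra σ) φ (x + h • ell k) - lap h (tetra σ) φ x) ^ 2
      ≤ goodSecond ell a b h φ x := by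
  have h0 : ∀ σ k, 0 ≤ rate a b h x k *
      (lap h (tetra σ) φ (x + h • ell k) - lap h (tetra σ) φ x) ^ 2 :=
    fun σ k => mul_nonneg (hC.rate_nonneg hh x k) (sq_nonneg _)
  refine (mul_le_mul_of_nonneg_right (hC.le_rate hh x k) (sq_nonneg _)).trans ?_
  refine (Finset.single_le_sum (f := fun k => rate a b h x k *
      (lap h (tetra σ) φ (x + h • ell k) - lap h (tetra σ) φ x) ^ 2)
    (fun k _ => h0 σ k) (Finset.mem_univ k)).trans ?_
  exact Finset.single_le_sum (f := fun σ => ∑ k, rate a b h x k *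
      (lap h (tetra σ) φ (x + h • ell k) - lap h (tetra σ) φ x) ^ 2)
    (fun σ _ => Finset.sum_nonneg fun k _ => h0 σ k) hσ

/-- `Δ_k` is, up to sign, the difference in the direction `k` of `δ_{-k}`, so it is one of the
increments summed in `goodFirst`. -/
theorem CoefBounds.le_goodFirst (hC : CoefBounds ell a b c f h K₀ K₃) (hh : 0 < h)
    (φ : Space d → ℝ) (x : Space d) (k : Idx d₁) :
    a k x * sd h (ell k) φ x ^ 2 ≤ goodFirst ell a b h φ x := by
  have h0 : ∀ j k, 0 ≤ rate a b h x k *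
      (fd h (ell j) φ (x + h • ell k) - fd h (ell j) φ x) ^ 2 :=
    fun j k => mul_nonneg (hC.rate_nonneg hh x k) (sq_nonneg _)
  have e : a k x * sd h (ell k) φ x ^ 2 = a k x / h ^ 2 *
      (fd h (ell k.opp) φ (x + h • ell k) - fd h (ell k.opp) φ x) ^ 2 := by
    rw [sd_eq_neg_fd_fd, fd, hC.ell_opp]
    field_simp
  rw [e]
  refine (mul_le_mul_of_nonneg_right (hC.le_rate hh x k) (sq_nonneg _)).trans ?_
  refine (Finset.single_le_sum (f := fun k' => rate a b h x k' *
      (fd h (ell k.opp) φ (x + h • ell k') - fd h (ell k.opp) φ x) ^ 2)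
    (fun k' _ => h0 _ k') (Finset.mem_univ k)).trans ?_
  exact Finset.single_le_sum (f := fun j => ∑ k', rate a b h x k' *
      (fd h (ell j) φ (x + h • ell k') - fd h (ell j) φ x) ^ 2)
    (fun j _ => Finset.sum_nonneg fun k _ => h0 j k) (Finset.mem_univ k.opp)

/-- The product rule for zero-sum second differences of the operator. -/
theorem CoefBounds.lap_oper (hC : CoefBounds ell a b c f h K₀ K₃) (P : Fin 4 → Space d)
    (ρ ν ζ : ℝ) (φ₀ φ₁ : Space d → ℝ) (x : Space d) :
    lap h P (oper ell a b c f h ρ ν ζ φ₀ φ₁) x =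
      jump ell a b h ρ (lap h P φ₀) (lap h P φ₁) x - (c x + ν) * lap h P φ₀ x
      + ∑ k, (sd h (ell k) φ₀ x * lap h P (a k) x
          + (∑ n, (a k (x + h • P n) - a k x)
              * (sd h (ell k) φ₀ (x + h • P n) - sd h (ell k) φ₀ x)) / h ^ 2
          + fd h (ell k) φ₀ x * lap h P (b k) x
          + (∑ n, (b k (x + h • P n) - b k x)
              * (fd h (ell k) φ₀ (x + h • P n) - fd h (ell k) φ₀ x)) / h ^ 2)
      - φ₀ x * lap h P c x
      - (∑ n, (c (x + h • P n) - c x) * (φ₀ (x + h • P n) - φ₀ x)) / h ^ 2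
      + ζ * lap h P f x := by
  have e : oper ell a b c f h ρ ν ζ φ₀ φ₁ = fun y => ρ * (φ₁ y - φ₀ y)
    + (∑ k, (a k y * sd h (ell k) φ₀ y + b k y * fd h (ell k) φ₀ y)) - (c y * φ₀ y + ν * φ₀ y)
    + ζ * f y := by
    funext y
    rw [oper]
    ring
  rw [e, lap_add, lap_sub, lap_add, lap_const_mul, lap_const_mul, lap_sub, lap_sum, lap_add,
    lap_const_mul, lap_mul, jump, ← hC.sum_eq]
  have e₂ : ∀ k, lap h P (fun y => a k y * sd h (ell k) φ₀ y + b k y * fd h (ell k) φ₀ y) x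
      = (a k x * sd h (ell k) (lap h P φ₀) x + b k x * fd h (ell k) (lap h P φ₀) x)
        + (sd h (ell k) φ₀ x * lap h P (a k) x
          + (∑ n, (a k (x + h • P n) - a k x)
              * (sd h (ell k) φ₀ (x + h • P n) - sd h (ell k) φ₀ x)) / h ^ 2
          + fd h (ell k) φ₀ x * lap h P (b k) x
          + (∑ n, (b k (x + h • P n) - b k x)
              * (fd h (ell k) φ₀ (x + h • P n) - fd h (ell k) φ₀ x)) / h ^ 2) := by
    intro k
    rw [lap_add, lap_mul, lap_mul, lap_sd, lap_fd]
    ring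
  simp only [e₂]
  rw [Finset.sum_add_distrib]
  ring

/-- The product rule for first differences of the operator. -/
theorem CoefBounds.fd_oper (hC : CoefBounds ell a b c f h K₀ K₃) (l : Space d)
    (ρ ν ζ : ℝ) (φ₀ φ₁ : Space d → ℝ) (x : Space d) :
    fd h l (oper ell a b c f h ρ ν ζ φ₀ φ₁) x =
      jump ell a b h ρ (fd h l φ₀) (fd h l φ₁) x - (c x + ν) * fd h l φ₀ x
      + ∑ k, (sd h (ell k) φ₀ (x + h • l) * fd h l (a k) x
          + fd h (ell k) φ₀ (x + h • l) * fd h l (b k) x)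
      - φ₀ (x + h • l) * fd h l c x + ζ * fd h l f x := by
  have e₂ : ∀ k, fd h l (fun y => a k y * sd h (ell k) φ₀ y + b k y * fd h (ell k) φ₀ y) x
      = (a k x * sd h (ell k) (fd h l φ₀) x + b k x * fd h (ell k) (fd h l φ₀) x)
        + (sd h (ell k) φ₀ (x + h • l) * fd h l (a k) x
          + fd h (ell k) φ₀ (x + h • l) * fd h l (b k) x) := by
    intro k
    rw [← fd_sd, fd_comm]
    simp only [fd]
    ring
  have e₃ := fd_sum (h := h) Finset.univ l
    (fun k y => a k y * sd h (ell k) φ₀ y + b k y * fd h (ell k) φ₀ y) x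
  rw [Finset.sum_congr rfl (fun k _ => e₂ k), Finset.sum_add_distrib] at e₃
  have e₄ : fd h l (oper ell a b c f h ρ ν ζ φ₀ φ₁) x = ρ * (fd h l φ₁ x - fd h l φ₀ x)
      + fd h l (fun y => ∑ k, (a k y * sd h (ell k) φ₀ y + b k y * fd h (ell k) φ₀ y)) x
      - ((c x + ν) * fd h l φ₀ x + φ₀ (x + h • l) * fd h l c x) + ζ * fd h l f x := by
    simp only [fd, oper]
    ring
  rw [e₄, e₃, jump, ← hC.sum_eq]
  ring

end Operator

/-! ### Errors of the product rules. -/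

section Errors

variable {d d₁ : ℕ} {ell : Idx d₁ → Space d} {a b : Idx d₁ → Space d → ℝ} {c f : Space d → ℝ}
  {h K₀ K₃ κ B m₂ : ℝ} {φ₀ φ₁ : Space d → ℝ} {x : Space d}

/-- Bounds for the differences of a function at a point and at its neighbours. -/
structure FunBounds (ell : Idx d₁ → Space d) (h κ B m₂ : ℝ) (φ : Space d → ℝ) (x : Space d) :
    Prop where
  lap_le : ∀ σ ∈ triples ell, ∀ y ∈ dirs ell, |lap h (tetra σ) φ (x + h • y)| ≤ κ
  fd_le : ∀ k ∈ dirs ell, ∀ y ∈ dirs ell, |fd h k φ (x + h • y)| ≤ B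
  val_le : ∀ y ∈ dirs ell, |φ (x + h • y)| ≤ B
  mixed_le : ∀ y ∈ dirs ell, ∀ k ∈ dirs ell, |fd h y (fd h k φ) x| ≤ m₂

theorem FunBounds.lap_le_self (hF : FunBounds ell h κ B m₂ φ₀ x) {σ : Space d × Space d × Space d}
    (hσ : σ ∈ triples ell) : |lap h (tetra σ) φ₀ x| ≤ κ := by
  simpa using hF.lap_le σ hσ 0 zero_mem_dirs

theorem FunBounds.fd_le_self (hF : FunBounds ell h κ B m₂ φ₀ x) {k : Space d} (hk : k ∈ dirs ell) :
    |fd h k φ₀ x| ≤ B := by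
  simpa using hF.fd_le k hk 0 zero_mem_dirs

theorem FunBounds.val_le_self (hF : FunBounds ell h κ B m₂ φ₀ x) : |φ₀ x| ≤ B := by
  simpa using hF.val_le 0 zero_mem_dirs

theorem FunBounds.sd_le (hF : FunBounds ell h κ B m₂ φ₀ x) (hopp : ∀ k, ell k.opp = -ell k)
    {k y : Space d} (hk : k ∈ dirs ell) (hy : y ∈ dirs ell) : |sd h k φ₀ (x + h • y)| ≤ κ := by
  rw [← lap_pure]
  exact hF.lap_le _ (pure_mem_triples hopp hk) y hy

theorem FunBounds.sd_le_self (hF : FunBounds ell h κ B m₂ φ₀ x) (hopp : ∀ k, ell k.opp = -ell k)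
    {k : Space d} (hk : k ∈ dirs ell) : |sd h k φ₀ x| ≤ κ := by
  rw [← lap_pure]
  exact hF.lap_le_self (pure_mem_triples hopp hk)

/-- The splitting property of the directions. -/
def HasSplits (ell : Idx d₁ → Space d) : Prop :=
  ∀ y ∈ dirs ell, ∀ k ∈ dirs ell, ∃ q ∈ dirs ell, ∃ q' ∈ dirs ell,
    q + q' = k ∧ y + q ∈ dirs ell ∧ y - q' ∈ dirs ell

theorem young {θ : ℝ} (hθ : 0 < θ) (p X : ℝ) : p * X ≤ θ * X ^ 2 + p ^ 2 / (4 * θ) := by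
  have e : θ * X ^ 2 + p ^ 2 / (4 * θ) - p * X = (2 * θ * X - p) ^ 2 / (4 * θ) := by
    field_simp
    ring
  have : 0 ≤ (2 * θ * X - p) ^ 2 / (4 * θ) := by positivity
  linarith

theorem CoefBounds.sqrt_mul_abs_lap_shift_le (hC : CoefBounds ell a b c f h K₀ K₃) (hh : 0 < h)
    {θ : ℝ} (hθ : 0 < θ) (φ : Space d → ℝ) (x : Space d) (k : Idx d₁)
    {σ : Space d × Space d × Space d} (hσ : σ ∈ triples ell) :
    √(a k x) / h * |lap h (tetra σ) φ (x + h • ell k) - lap h (tetra σ) φ x|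
      ≤ θ * goodSecond ell a b h φ x + 1 / (4 * θ) := by
  have h1 := young hθ 1
    (√(a k x) / h * |lap h (tetra σ) φ (x + h • ell k) - lap h (tetra σ) φ x|)
  have h2 := hC.le_goodSecond hh φ x k hσ
  rw [mul_pow, div_pow, Real.sq_sqrt (hC.a_nonneg k x), sq_abs, one_mul, one_pow] at h1
  have := mul_le_mul_of_nonneg_left h2 hθ.le
  linarith

/-- The third difference in an arbitrary direction `y` is traded, by `sd_shift_sub`, for six
increments in the directions `±k`, each controlled by `goodSecond` with weight `a_k`. -/
theorem CoefBounds.sqrt_mul_abs_sd_shift_le (hC : CoefBounds ell a b c f h K₀ K₃) (hh : 0 < h)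
    (hsplit : HasSplits ell) {θ : ℝ} (hθ : 0 < θ) (φ : Space d → ℝ) (x : Space d) (k : Idx d₁)
    {y : Space d} (hy : y ∈ dirs ell) :
    √(a k x) / h * |sd h (ell k) φ (x + h • y) - sd h (ell k) φ x|
      ≤ 6 * (θ * goodSecond ell a b h φ x + 1 / (4 * θ)) := by
  obtain ⟨q, hq, q', hq', hqq, hyq, hyq'⟩ := hsplit y hy _ (ell_mem_dirs k)
  have hk := ell_mem_dirs (ell := ell) k
  have hs : 0 ≤ √(a k x) / h := div_nonneg (Real.sqrt_nonneg _) hh.le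
  have T₁ : (-ell k, y, -q') ∈ triples ell := by
    refine mem_triples.2 ⟨neg_mem_dirs hC.ell_opp hk, hy, neg_mem_dirs hC.ell_opp hq', ?_, ?_⟩
    · rwa [← hqq, show -q' - -(q + q') = q by abel]
    · rwa [show -q' + y = y - q' by abel]
  have T₂ : (ell k, y, q) ∈ triples ell := by
    refine mem_triples.2 ⟨hk, hy, hq, ?_, ?_⟩
    · rw [← hqq, show q - (q + q') = -q' by abel]
      exact neg_mem_dirs hC.ell_opp hq'
    · rwa [add_comm]
  have b₁ := hC.sqrt_mul_abs_lap_shift_le hh hθ φ x k T₁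
  have b₂ := hC.sqrt_mul_abs_lap_shift_le hh hθ φ x k (pure_mem_triples hC.ell_opp hq)
  have b₃ := hC.sqrt_mul_abs_lap_shift_le hh hθ φ x k (pure_mem_triples hC.ell_opp hyq')
  -- The shifts by `-k` carry the same weight because `a` is even in `k`.
  have b₄ := hC.sqrt_mul_abs_lap_shift_le hh hθ φ x k.opp T₂
  have b₅ := hC.sqrt_mul_abs_lap_shift_le hh hθ φ x k.opp (pure_mem_triples hC.ell_opp hq')
  have b₆ := hC.sqrt_mul_abs_lap_shift_le hh hθ φ x k.opp (pure_mem_triples hC.ell_opp hyq)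
  rw [hC.a_opp, hC.ell_opp] at b₄ b₅ b₆
  simp only [lap_pure] at b₂ b₃ b₅ b₆
  rw [sd_shift_sub hqq φ x]
  have tri : ∀ p₁ p₂ p₃ p₄ p₅ p₆ : ℝ, |p₁ - p₂ - p₃ + p₄ - p₅ - p₆|
      ≤ |p₁| + |p₂| + |p₃| + |p₄| + |p₅| + |p₆| := by
    intro p₁ p₂ p₃ p₄ p₅ p₆
    have := neg_abs_le p₁
    have := neg_abs_le p₂
    have := neg_abs_le p₃
    have := neg_abs_le p₄
    have := neg_abs_le p₅
    have := neg_abs_le p₆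
    have := le_abs_self p₁
    have := le_abs_self p₂
    have := le_abs_self p₃
    have := le_abs_self p₄
    have := le_abs_self p₅
    have := le_abs_self p₆
    rw [abs_le]
    constructor <;> linarith
  refine (mul_le_mul_of_nonneg_left (tri _ _ _ _ _ _) hs).trans ?_
  linarith

theorem abs_sum_four_div_le {g : Fin 4 → ℝ} {t C : ℝ} (ht : 0 < t) (hg : ∀ n, |g n| ≤ t * C) :
    |(∑ n, g n) / t| ≤ 4 * C := by
  rw [abs_div, abs_of_pos ht, div_le_iff₀ ht]
  refine (Finset.abs_sum_le_sum_abs _ _).trans ((Finset.sum_le_sum fun n _ => hg n).trans ?_)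
  simp
  linarith

/-- The error of the product rule in the direction `k`, for zero-sum second differences. -/
theorem CoefBounds.second_error_le (hC : CoefBounds ell a b c f h K₀ K₃) (hh : 0 < h)
    (hK₀ : 0 ≤ K₀) (hK₃ : 0 ≤ K₃) (hsplit : HasSplits ell) {θ₁ θ₂ : ℝ} (hθ₁ : 0 < θ₁)
    (hθ₂ : 0 < θ₂) (hF : FunBounds ell h κ B m₂ φ₀ x)
    {σ : Space d × Space d × Space d} (hσ : σ ∈ triples ell) (k : Idx d₁) :
    |sd h (ell k) φ₀ x * lap h (tetra σ) (a k) x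
          + (∑ n, (a k (x + h • tetra σ n) - a k x)
              * (sd h (ell k) φ₀ (x + h • tetra σ n) - sd h (ell k) φ₀ x)) / h ^ 2
          + fd h (ell k) φ₀ x * lap h (tetra σ) (b k) x
          + (∑ n, (b k (x + h • tetra σ n) - b k x)
              * (fd h (ell k) φ₀ (x + h • tetra σ n) - fd h (ell k) φ₀ x)) / h ^ 2|
      ≤ (3 * K₀ * κ + (θ₂ * goodFirst ell a b h φ₀ x + (3 * K₃) ^ 2 / (4 * θ₂)))
        + 4 * (K₀ ^ 2 * (6 * (θ₁ * goodSecond ell a b h φ₀ x + 1 / (4 * θ₁))) + 2 * K₀ ^ 3 * κ)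
        + 3 * K₃ * B + 4 * (K₀ ^ 2 * m₂) := by
  have hk := ell_mem_dirs (ell := ell) k
  have hP : ∀ n, tetra σ n ∈ dirs ell := fun n => tetra_mem_dirs hC.ell_opp hσ n
  have hs := Real.sqrt_nonneg (a k x)
  have hw := hF.sd_le_self hC.ell_opp hk
  have hκ : 0 ≤ κ := (abs_nonneg _).trans hw
  have hfd := hF.fd_le_self hk
  -- The part of the bound on the second difference of `a_k` with `K₃ √a_k` goes into `goodFirst`;
  -- only the part with `K₀` is charged to `κ`. This keeps `K₃` out of the bound for `λ`.
  have t₁ : |sd h (ell k) φ₀ x * lap h (tetra σ) (a k) x|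
      ≤ 3 * K₀ * κ + (θ₂ * goodFirst ell a b h φ₀ x + (3 * K₃) ^ 2 / (4 * θ₂)) := by
    rw [abs_mul]
    have h1 := mul_le_mul_of_nonneg_left (hC.lap_a k x σ hσ) (abs_nonneg (sd h (ell k) φ₀ x))
    have h2 := young hθ₂ (3 * K₃) (√(a k x) * |sd h (ell k) φ₀ x|)
    rw [mul_pow, Real.sq_sqrt (hC.a_nonneg k x), sq_abs] at h2
    have h3 := mul_le_mul_of_nonneg_left (hC.le_goodFirst hh φ₀ x k) hθ₂.le
    have h4 := mul_le_mul_of_nonneg_left hw (show 0 ≤ 3 * K₀ by positivity)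
    linarith
  -- The increment of `a_k` is of order `h (√a_k + h)`. The root is matched with `goodSecond`; the
  -- extra `h` cancels the remaining denominator, so there the crude bound `2 κ` suffices.
  have t₂ : |(∑ n, (a k (x + h • tetra σ n) - a k x)
      * (sd h (ell k) φ₀ (x + h • tetra σ n) - sd h (ell k) φ₀ x)) / h ^ 2|
      ≤ 4 * (K₀ ^ 2 * (6 * (θ₁ * goodSecond ell a b h φ₀ x + 1 / (4 * θ₁)))
        + 2 * K₀ ^ 3 * κ) := by
    refine abs_sum_four_div_le (by positivity) fun n => ?_
    have h1 := hC.a_shift k x _ (hP n)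
    have h2 := hC.sqrt_mul_abs_sd_shift_le hh hsplit hθ₁ φ₀ x k (hP n)
    have h3 : |sd h (ell k) φ₀ (x + h • tetra σ n) - sd h (ell k) φ₀ x| ≤ 2 * κ := by
      refine (abs_sub _ _).trans ?_
      have := hF.sd_le hC.ell_opp hk (hP n)
      linarith
    rw [abs_mul]
    have hW := abs_nonneg (sd h (ell k) φ₀ (x + h • tetra σ n) - sd h (ell k) φ₀ x)
    generalize |sd h (ell k) φ₀ (x + h • tetra σ n) - sd h (ell k) φ₀ x| = W at *
    generalize 6 * (θ₁ * goodSecond ell a b h φ₀ x + 1 / (4 * θ₁)) = G at *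
    rw [div_mul_eq_mul_div, div_le_iff₀ hh] at h2
    calc _ ≤ K₀ ^ 2 * h * (√(a k x) + K₀ * h) * W := by gcongr
      _ = K₀ ^ 2 * h * (√(a k x) * W) + K₀ ^ 3 * h ^ 2 * W := by ring
      _ ≤ K₀ ^ 2 * h * (G * h) + K₀ ^ 3 * h ^ 2 * (2 * κ) := by gcongr
      _ = _ := by ring
  have t₃ : |fd h (ell k) φ₀ x * lap h (tetra σ) (b k) x| ≤ 3 * K₃ * B := by
    rw [abs_mul, mul_comm]
    exact mul_le_mul (hC.lap_b k x σ hσ) hfd (abs_nonneg _) (by positivity)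
  have t₄ : |(∑ n, (b k (x + h • tetra σ n) - b k x)
      * (fd h (ell k) φ₀ (x + h • tetra σ n) - fd h (ell k) φ₀ x)) / h ^ 2|
      ≤ 4 * (K₀ ^ 2 * m₂) := by
    refine abs_sum_four_div_le (by positivity) fun n => ?_
    have h1 := hC.b_shift k x _ (hP n)
    have h2 := hF.mixed_le _ (hP n) _ hk
    rw [fd, abs_div, abs_of_pos hh, div_le_iff₀ hh] at h2
    rw [abs_mul]
    calc _ ≤ K₀ ^ 2 * h * (m₂ * h) := mul_le_mul h1 h2 (abs_nonneg _) (by positivity)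
      _ = _ := by ring
  refine (abs_add_le _ _).trans (add_le_add ((abs_add_le _ _).trans (add_le_add
    ((abs_add_le _ _).trans (add_le_add t₁ t₂)) t₃)) t₄)

theorem card_univ_idx : ((Finset.univ : Finset (Idx d₁)).card : ℝ) = 2 * d₁ := by
  simp [Idx, Finset.card_univ]
  ring

theorem abs_sum_idx_le {g : Idx d₁ → ℝ} {C : ℝ} (hg : ∀ k, |g k| ≤ C) :
    |∑ k, g k| ≤ 2 * d₁ * C := by
  refine (Finset.abs_sum_le_sum_abs _ _).trans ((Finset.sum_le_sum fun k _ => hg k).trans ?_)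
  rw [Finset.sum_const, nsmul_eq_mul, card_univ_idx]

/-- Zero-sum second differences are almost supersolutions. -/
theorem CoefBounds.jump_lap_le (hC : CoefBounds ell a b c f h K₀ K₃) (hh : 0 < h)
    (hK₀ : 0 ≤ K₀) (hK₃ : 0 ≤ K₃) (hsplit : HasSplits ell) {θ₁ θ₂ : ℝ} (hθ₁ : 0 < θ₁)
    (hθ₂ : 0 < θ₂) (hF : FunBounds ell h κ B m₂ φ₀ x) {ρ ν ζ s : ℝ} (hζ : |ζ| ≤ B)
    {σ : Space d × Space d × Space d} (hσ : σ ∈ triples ell)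
    (hs : lap h (tetra σ) (oper ell a b c f h ρ ν ζ φ₀ φ₁) x ≤ s) :
    jump ell a b h ρ (lap h (tetra σ) φ₀) (lap h (tetra σ) φ₁) x ≤
      (c x + ν) * lap h (tetra σ) φ₀ x + s + 2 * d₁ * ((3 * K₀ * κ
        + (θ₂ * goodFirst ell a b h φ₀ x + (3 * K₃) ^ 2 / (4 * θ₂)))
        + 4 * (K₀ ^ 2 * (6 * (θ₁ * goodSecond ell a b h φ₀ x + 1 / (4 * θ₁))) + 2 * K₀ ^ 3 * κ)
        + 3 * K₃ * B + 4 * (K₀ ^ 2 * m₂)) + (6 * K₃ + 4 * (K₃ * K₀)) * B := by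
  rw [hC.lap_oper] at hs
  have e₁ := abs_le.1 (abs_sum_idx_le fun k =>
    hC.second_error_le hh hK₀ hK₃ hsplit hθ₁ hθ₂ hF hσ k)
  have e₂ : |φ₀ x * lap h (tetra σ) c x| ≤ 3 * K₃ * B := by
    rw [abs_mul, mul_comm]
    exact mul_le_mul (hC.lap_c x σ hσ) hF.val_le_self (abs_nonneg _) (by positivity)
  have e₃ : |(∑ n, (c (x + h • tetra σ n) - c x) * (φ₀ (x + h • tetra σ n) - φ₀ x)) / h ^ 2|
      ≤ 4 * (K₃ * K₀ * B) := by
    refine abs_sum_four_div_le (by positivity) fun n => ?_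
    have hP := tetra_mem_dirs hC.ell_opp hσ n
    have h1 := hC.c_shift x _ hP
    have h2 := hF.fd_le_self hP
    rw [fd, abs_div, abs_of_pos hh, div_le_iff₀ hh] at h2
    rw [abs_mul]
    calc _ ≤ K₃ * K₀ * h * (B * h) := mul_le_mul h1 h2 (abs_nonneg _) (by positivity)
      _ = _ := by ring
  have e₄ : |ζ * lap h (tetra σ) f x| ≤ 3 * K₃ * B := by
    rw [abs_mul, mul_comm]
    exact mul_le_mul (hC.lap_f x σ hσ) hζ (abs_nonneg _) (by positivity)
  have e₂ := abs_le.1 e₂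
  have e₃ := abs_le.1 e₃
  have e₄ := abs_le.1 e₄
  linarith [e₁.1, e₂.2, e₃.2, e₄.1]

/-- First differences are almost supersolutions. -/
theorem CoefBounds.jump_fd_le (hC : CoefBounds ell a b c f h K₀ K₃) (hh : 0 < h) (hh1 : h ≤ 1)
    (hK₀ : 0 ≤ K₀) (hK₃ : 0 ≤ K₃) (hF : FunBounds ell h κ B m₂ φ₀ x) {ρ ν ζ s : ℝ}
    (hζ : |ζ| ≤ B) {l : Space d} (hl : l ∈ dirs ell)
    (hs : fd h l (oper ell a b c f h ρ ν ζ φ₀ φ₁) x ≤ s) :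
    jump ell a b h ρ (fd h l φ₀) (fd h l φ₁) x ≤ (c x + ν) * fd h l φ₀ x + s
      + 2 * d₁ * (K₀ ^ 2 * (√K₀ + K₀) * κ + K₀ ^ 2 * B) + (K₃ * K₀ + K₃) * B := by
  rw [hC.fd_oper] at hs
  have div_le : ∀ {ψ : Space d → ℝ} {C : ℝ}, |ψ (x + h • l) - ψ x| ≤ C * h → |fd h l ψ x| ≤ C := by
    intro ψ C hψ
    rwa [fd, abs_div, abs_of_pos hh, div_le_iff₀ hh]
  have hB : 0 ≤ B := (abs_nonneg _).trans hF.val_le_self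
  have e₁ := abs_le.1 (abs_sum_idx_le (g := fun k =>
      sd h (ell k) φ₀ (x + h • l) * fd h l (a k) x + fd h (ell k) φ₀ (x + h • l) * fd h l (b k) x)
      (C := K₀ ^ 2 * (√K₀ + K₀) * κ + K₀ ^ 2 * B) fun k => by
    have hk := ell_mem_dirs (ell := ell) k
    refine (abs_add_le _ _).trans (add_le_add ?_ ?_)
    · rw [abs_mul, mul_comm]
      refine mul_le_mul (div_le ((hC.a_shift k x l hl).trans ?_)) (hF.sd_le hC.ell_opp hk hl)
        (abs_nonneg _) (by positivity)
      have h1 : √(a k x) ≤ √K₀ := Real.sqrt_le_sqrt (hC.a_le k x)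
      have h2 : K₀ * h ≤ K₀ := mul_le_of_le_one_right hK₀ hh1
      calc _ ≤ K₀ ^ 2 * h * (√K₀ + K₀) := by gcongr
        _ = _ := by ring
    · rw [abs_mul, mul_comm]
      exact mul_le_mul (div_le (hC.b_shift k x l hl)) (hF.fd_le _ hk l hl) (abs_nonneg _)
        (by positivity))
  have e₂ : |φ₀ (x + h • l) * fd h l c x| ≤ K₃ * K₀ * B := by
    rw [abs_mul, mul_comm]
    exact mul_le_mul (div_le (hC.c_shift x l hl)) (hF.val_le l hl) (abs_nonneg _) (by positivity)
  have e₃ : |ζ * fd h l f x| ≤ K₃ * B := by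
    rw [abs_mul, mul_comm]
    exact mul_le_mul (div_le (hC.f_shift x l hl)) hζ (abs_nonneg _) hK₃
  have e₂ := abs_le.1 e₂
  have e₃ := abs_le.1 e₃
  linarith [e₁.1, e₂.2, e₃.1]

end Errors

/-! ### The auxiliary function and the contradiction at its maximum. -/

section Bernstein

variable {d d₁ : ℕ} {ell : Idx d₁ → Space d} {a b : Idx d₁ → Space d → ℝ} {c f : Space d → ℝ}
  {h K₀ K₃ κ B m₂ ρ : ℝ} {φ₀ φ₁ : Space d → ℝ} {x : Space d}

theorem jump_add (u₀ u₁ w₀ w₁ : Space d → ℝ) :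
    jump ell a b h ρ (fun y => u₀ y + w₀ y) (fun y => u₁ y + w₁ y) x
      = jump ell a b h ρ u₀ u₁ x + jump ell a b h ρ w₀ w₁ x := by
  have e : ∀ k, rate a b h x k * (u₀ (x + h • ell k) + w₀ (x + h • ell k) - (u₀ x + w₀ x))
      = rate a b h x k * (u₀ (x + h • ell k) - u₀ x)
        + rate a b h x k * (w₀ (x + h • ell k) - w₀ x) := fun k => by ring
  simp only [jump, e, Finset.sum_add_distrib]
  ring

theorem jump_const_mul (p : ℝ) (u₀ u₁ : Space d → ℝ) :
    jump ell a b h ρ (fun y => p * u₀ y) (fun y => p * u₁ y) x = p * jump ell a b h ρ u₀ u₁ x := by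
  have e : ∀ k, rate a b h x k * (p * u₀ (x + h • ell k) - p * u₀ x)
      = p * (rate a b h x k * (u₀ (x + h • ell k) - u₀ x)) := fun k => by ring
  simp only [jump, e, ← Finset.mul_sum]
  ring

theorem jump_sum {ι : Type*} (s : Finset ι) (u₀ u₁ : ι → Space d → ℝ) :
    jump ell a b h ρ (fun y => ∑ i ∈ s, u₀ i y) (fun y => ∑ i ∈ s, u₁ i y) x
      = ∑ i ∈ s, jump ell a b h ρ (u₀ i) (u₁ i) x := by
  classical
  induction s using Finset.induction_on with
  | empty => simp [jump]
  | insert i s hi ih =>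
    simp only [Finset.sum_insert hi]
    rw [jump_add, ih]

/-- The chain rule for the square `(κ - u)²`. -/
theorem le_jump_sq (hρ : 0 ≤ ρ) (κ : ℝ) (u₀ u₁ : Space d → ℝ) :
    -2 * (κ - u₀ x) * jump ell a b h ρ u₀ u₁ x
        + ∑ k, rate a b h x k * (u₀ (x + h • ell k) - u₀ x) ^ 2
      ≤ jump ell a b h ρ (fun y => (κ - u₀ y) ^ 2) (fun y => (κ - u₁ y) ^ 2) x := by
  have e : ∀ k, rate a b h x k * ((κ - u₀ (x + h • ell k)) ^ 2 - (κ - u₀ x) ^ 2)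
      = -2 * (κ - u₀ x) * (rate a b h x k * (u₀ (x + h • ell k) - u₀ x))
        + rate a b h x k * (u₀ (x + h • ell k) - u₀ x) ^ 2 := fun k => by ring
  -- The square of the time jump has the favourable sign and is dropped.
  have h1 : 0 ≤ ρ * (u₁ x - u₀ x) ^ 2 := by positivity
  simp only [jump, e, Finset.sum_add_distrib, ← Finset.mul_sum]
  linarith

theorem jump_nonpos (hρ : 0 ≤ ρ) (hrate : ∀ k, 0 ≤ rate a b h x k) {u₀ u₁ : Space d → ℝ}
    (h₁ : u₁ x ≤ u₀ x) (h₀ : ∀ k, u₀ (x + h • ell k) ≤ u₀ x) :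
    jump ell a b h ρ u₀ u₁ x ≤ 0 := by
  have h2 : ∑ k, rate a b h x k * (u₀ (x + h • ell k) - u₀ x) ≤ 0 :=
    Finset.sum_nonpos fun k _ => mul_nonpos_of_nonneg_of_nonpos (hrate k) (by linarith [h₀ k])
  have h3 := mul_nonpos_of_nonneg_of_nonpos hρ (sub_nonpos.2 h₁)
  rw [jump]
  linarith

/-- A supersolution bound for `u` gives a lower bound for the operator on `(κ - u)²`. -/
theorem le_jump_sq_of_super (hρ : 0 ≤ ρ) {u₀ u₁ : Space d → ℝ} {lam E : ℝ} (hlam : 0 ≤ lam)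
    (hE : 0 ≤ E) (hκ : |u₀ x| ≤ κ) (hu : jump ell a b h ρ u₀ u₁ x ≤ lam * u₀ x + E) :
    ∑ k, rate a b h x k * (u₀ (x + h • ell k) - u₀ x) ^ 2 - lam * (κ ^ 2 / 2) - 4 * κ * E
      ≤ jump ell a b h ρ (fun y => (κ - u₀ y) ^ 2) (fun y => (κ - u₁ y) ^ 2) x := by
  have h0 := le_jump_sq (ell := ell) (a := a) (b := b) (h := h) (x := x) hρ κ u₀ u₁
  obtain ⟨h1, h2⟩ := abs_le.1 hκ
  -- The shift by `κ` serves here: multiplying a one-sided inequality requires `κ - u₀ ≥ 0`.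
  have h3 := mul_le_mul_of_nonneg_left hu (sub_nonneg.2 h2)
  have h4 : (κ - u₀ x) * E ≤ 2 * κ * E := mul_le_mul_of_nonneg_right (by linarith) hE
  have h5 : lam * ((κ - u₀ x) * u₀ x) ≤ lam * (κ ^ 2 / 4) :=
    mul_le_mul_of_nonneg_left (by nlinarith [sq_nonneg (κ - 2 * u₀ x)]) hlam
  linarith

/-- The function to which the maximum principle is applied. -/
def bern (ell : Idx d₁ → Space d) (h κ B p q : ℝ) (π : Space d × Space d × Space d)
    (φ : Space d → ℝ) (x : Space d) : ℝ :=
  (-1) * lap h (tetra π) φ x + p * (∑ σ ∈ triples ell, (κ - lap h (tetra σ) φ x) ^ 2)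
    + q * ∑ j, (B - fd h (ell j) φ x) ^ 2

theorem jump_bern_ge (hρ : 0 ≤ ρ) {p q lam E E' : ℝ} (hp : 0 ≤ p) (hq : 0 ≤ q) (hlam : 0 ≤ lam)
    (hE : 0 ≤ E) (hE' : 0 ≤ E') (hκ : 0 ≤ κ)
    {π : Space d × Space d × Space d} (hπ : π ∈ triples ell)
    (hzκ : ∀ σ ∈ triples ell, |lap h (tetra σ) φ₀ x| ≤ κ)
    (hsB : ∀ j, |fd h (ell j) φ₀ x| ≤ B)
    (hz : ∀ σ ∈ triples ell, jump ell a b h ρ (lap h (tetra σ) φ₀) (lap h (tetra σ) φ₁) x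
      ≤ lam * lap h (tetra σ) φ₀ x + E)
    (hs : ∀ j, jump ell a b h ρ (fd h (ell j) φ₀) (fd h (ell j) φ₁) x
      ≤ lam * fd h (ell j) φ₀ x + E') :
    lam * (-lap h (tetra π) φ₀ x) - E + p * goodSecond ell a b h φ₀ x
        - p * ((2 * d₁ + 1) ^ 3 * (lam * (κ ^ 2 / 2) + 4 * κ * E))
        + q * goodFirst ell a b h φ₀ x - q * (2 * d₁ * (lam * (B ^ 2 / 2) + 4 * B * E'))
      ≤ jump ell a b h ρ (bern ell h κ B p q π φ₀) (bern ell h κ B p q π φ₁) x := by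
  have e : jump ell a b h ρ (bern ell h κ B p q π φ₀) (bern ell h κ B p q π φ₁) x
      = (-1) * jump ell a b h ρ (lap h (tetra π) φ₀) (lap h (tetra π) φ₁) x
        + p * ∑ σ ∈ triples ell, jump ell a b h ρ (fun y => (κ - lap h (tetra σ) φ₀ y) ^ 2)
            (fun y => (κ - lap h (tetra σ) φ₁ y) ^ 2) x
        + q * ∑ j, jump ell a b h ρ (fun y => (B - fd h (ell j) φ₀ y) ^ 2)
            (fun y => (B - fd h (ell j) φ₁ y) ^ 2) x := by
    rw [← jump_sum, ← jump_sum, ← jump_const_mul, ← jump_const_mul, ← jump_const_mul, ← jump_add,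
      ← jump_add]
    rfl
  have h1 : goodSecond ell a b h φ₀ x - (2 * d₁ + 1) ^ 3 * (lam * (κ ^ 2 / 2) + 4 * κ * E)
      ≤ ∑ σ ∈ triples ell, jump ell a b h ρ (fun y => (κ - lap h (tetra σ) φ₀ y) ^ 2)
            (fun y => (κ - lap h (tetra σ) φ₁ y) ^ 2) x := by
    refine le_trans ?_ (Finset.sum_le_sum fun σ hσ =>
      le_jump_sq_of_super hρ hlam hE (hzκ σ hσ) (hz σ hσ))
    simp only [sub_sub, Finset.sum_sub_distrib, Finset.sum_const, nsmul_eq_mul]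
    have hc : ((triples ell).card : ℝ) ≤ (2 * d₁ + 1) ^ 3 := by
      exact_mod_cast card_triples_le (ell := ell)
    have h0 : 0 ≤ lam * (κ ^ 2 / 2) + 4 * κ * E := by positivity
    have := mul_le_mul_of_nonneg_right hc h0
    rw [goodSecond]
    linarith
  have h2 : goodFirst ell a b h φ₀ x - 2 * d₁ * (lam * (B ^ 2 / 2) + 4 * B * E')
      ≤ ∑ j, jump ell a b h ρ (fun y => (B - fd h (ell j) φ₀ y) ^ 2)
            (fun y => (B - fd h (ell j) φ₁ y) ^ 2) x := by
    refine le_trans ?_ (Finset.sum_le_sum fun j _ =>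
      le_jump_sq_of_super hρ hlam hE' (hsB j) (hs j))
    simp only [sub_sub, Finset.sum_sub_distrib, Finset.sum_const, nsmul_eq_mul]
    rw [goodFirst, card_univ_idx]
  have h3 := hz π hπ
  rw [e]
  linarith [mul_le_mul_of_nonneg_left h1 hp, mul_le_mul_of_nonneg_left h2 hq]

/-- The ratio of the bound for `|z|` and the bound for `z⁻`. -/
def cRatio (d₁ : ℕ) (δ K₀ : ℝ) : ℝ := 8 * (2 * d₁ * K₀ + 1) / δ + 1

/-- The weight of the sum of squares of second differences. -/
def cEps (d₁ : ℕ) (δ K₀ : ℝ) : ℝ := 1 / (16 * (2 * d₁ + 1) ^ 3 * cRatio d₁ δ K₀)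

/-- The constant in the bound of the errors for second differences. -/
def cErr (d₁ : ℕ) (δ K₀ : ℝ) : ℝ :=
  2 + 2 * d₁ * (3 * K₀ * cRatio d₁ δ K₀ + 9 / 2 * (2 * d₁ + 1)
    + 4 * (K₀ ^ 2 * (6 * (12 * (2 * d₁ + 1) * (K₀ ^ 2 + 1) * cRatio d₁ δ K₀ / cEps d₁ δ K₀))
      + 2 * K₀ ^ 3 * cRatio d₁ δ K₀)
    + 4 * (K₀ ^ 2 * (12 * cRatio d₁ δ K₀)))

/-- The lower bound for `λ`. -/
def cLam (d₁ : ℕ) (δ K₀ : ℝ) : ℝ := 8 * cErr d₁ δ K₀ + 5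

/-- The constant in the bound of the errors for first differences. -/
def cErrFirst (d₁ : ℕ) (δ K₀ K₃ : ℝ) : ℝ :=
  1 + 2 * d₁ * (K₀ ^ 2 * (√K₀ + K₀) * cRatio d₁ δ K₀ + K₀ ^ 2) + (K₃ * K₀ + K₃)

/-- The factor by which the second differences would have to exceed the data. -/
def cBig (d₁ : ℕ) (δ K₀ K₃ : ℝ) : ℝ :=
  16 + (2 * d₁ * (3 * K₃) + (6 * K₃ + 4 * (K₃ * K₀)))
    + 16 * (K₃ ^ 2 + 1) * (2 * d₁) * cErrFirst d₁ δ K₀ K₃ + 2 * d₁ * K₃ + 3 * K₃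

theorem one_le_cRatio {δ : ℝ} (hδ : 0 < δ) (hK₀ : 0 ≤ K₀) : 1 ≤ cRatio d₁ δ K₀ := by
  have : 0 ≤ 8 * (2 * d₁ * K₀ + 1) / δ := by positivity
  rw [cRatio]
  linarith

theorem cEps_pos {δ : ℝ} (hδ : 0 < δ) (hK₀ : 0 ≤ K₀) : 0 < cEps d₁ δ K₀ := by
  have := one_le_cRatio (d₁ := d₁) hδ hK₀
  rw [cEps]
  positivity

theorem cEps_mul {δ : ℝ} (hδ : 0 < δ) (hK₀ : 0 ≤ K₀) :
    cEps d₁ δ K₀ * (16 * (2 * d₁ + 1) ^ 3 * cRatio d₁ δ K₀) = 1 := by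
  have := one_le_cRatio (d₁ := d₁) hδ hK₀
  rw [cEps]
  field_simp

theorem one_le_cErrFirst {δ : ℝ} (hδ : 0 < δ) (hK₀ : 0 ≤ K₀) (hK₃ : 0 ≤ K₃) :
    1 ≤ cErrFirst d₁ δ K₀ K₃ := by
  have h1 := one_le_cRatio (d₁ := d₁) hδ hK₀
  have : 0 ≤ 2 * d₁ * (K₀ ^ 2 * (√K₀ + K₀) * cRatio d₁ δ K₀ + K₀ ^ 2) := by positivity
  have : 0 ≤ K₃ * K₀ + K₃ := by positivity
  rw [cErrFirst]
  linarith

theorem cErr_nonneg {δ : ℝ} (hδ : 0 < δ) (hK₀ : 0 ≤ K₀) : 0 ≤ cErr d₁ δ K₀ := by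
  have h1 := one_le_cRatio (d₁ := d₁) hδ hK₀
  have h2 := cEps_pos (d₁ := d₁) hδ hK₀
  rw [cErr]
  positivity

/-- The consequences of `cBig * B ≤ M` which are used. -/
theorem cBig_spec {δ M : ℝ} (hδ : 0 < δ) (hK₀ : 0 ≤ K₀) (hK₃ : 0 ≤ K₃) (hB : 1 ≤ B)
    (hM : cBig d₁ δ K₀ K₃ * B ≤ M) :
    16 * B ≤ M ∧ (2 * d₁ * (3 * K₃) + (6 * K₃ + 4 * (K₃ * K₀))) * B ≤ M ∧
      16 * (K₃ ^ 2 + 1) * (2 * d₁) * cErrFirst d₁ δ K₀ K₃ * B ≤ M ∧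
      16 * (K₃ ^ 2 + 1) * (2 * d₁) * B ≤ M ∧ (2 * d₁ * K₃ + 3 * K₃) * B ≤ M := by
  have h1 := one_le_cErrFirst (d₁ := d₁) hδ hK₀ hK₃
  have hB0 : 0 ≤ B := by linarith
  have p1 : 0 ≤ (2 * d₁ * (3 * K₃) + (6 * K₃ + 4 * (K₃ * K₀))) * B := by positivity
  have p2 : 0 ≤ 16 * (K₃ ^ 2 + 1) * (2 * d₁) * B := by positivity
  have p3 : 0 ≤ (2 * d₁ * K₃ + 3 * K₃) * B := by positivity
  have p4 := mul_le_mul_of_nonneg_left h1 p2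
  have e : cBig d₁ δ K₀ K₃ * B = 16 * B + (2 * d₁ * (3 * K₃) + (6 * K₃ + 4 * (K₃ * K₀))) * B
    + 16 * (K₃ ^ 2 + 1) * (2 * d₁) * B * cErrFirst d₁ δ K₀ K₃ + (2 * d₁ * K₃ + 3 * K₃) * B := by
    rw [cBig]
    ring
  rw [e] at hM
  refine ⟨by linarith, by linarith, by linarith, by linarith, by linarith⟩

/-- The weight `ε / κ` makes the cost of the squares linear in `M`; the choice of `ε` limits it to a
small fraction of `λ M` plus one more copy of `E`. -/
theorem absorb_second {ε r M lam E t : ℝ} (hlam : 0 ≤ lam) (hM : 0 < M) (hr : 1 ≤ r)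
    (hεr : ε * (16 * (2 * t + 1) ^ 3 * r) = 1) (hE : 0 ≤ E) :
    ε / (r * M) * ((2 * t + 1) ^ 3 * (lam * ((r * M) ^ 2 / 2) + 4 * (r * M) * E))
      ≤ lam * M / 8 + E := by
  have hr0 : 0 < r := by linarith
  have e : ε / (r * M) * ((2 * t + 1) ^ 3 * (lam * ((r * M) ^ 2 / 2) + 4 * (r * M) * E))
      = ε * (16 * (2 * t + 1) ^ 3 * r) * (lam * M / 32 + E / r / 4) := by
    field_simp
    ring
  rw [e, hεr, one_mul]
  have := div_le_self hE hr
  have := mul_nonneg hlam hM.le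
  linarith

/-- The cost is quadratic in `B` or proportional to `B M`, divided by `M`; largeness of `M / B`
makes it negligible. -/
theorem absorb_first {m n M lam C : ℝ} (hM : 0 < M) (hlam : 0 ≤ lam) (hB : 0 ≤ B) (hBM : B ≤ M) (h₁ : 16 * m * n * B ≤ M) (h₂ : 16 * m * n * C * B ≤ M) :
    m / M * (n * (lam * (B ^ 2 / 2) + 4 * B * (C * M))) ≤ lam * M / 8 + M := by
  have e : m / M * (n * (lam * (B ^ 2 / 2) + 4 * B * (C * M)))
      = lam / 32 * ((16 * m * n * B) * (B / M)) + 1 / 4 * (16 * m * n * C * B) := by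
    field_simp
    ring
  rw [e]
  have q1 : B / M ≤ 1 := (div_le_one hM).2 hBM
  have q2 : 16 * m * n * B * (B / M) ≤ M * 1 := mul_le_mul h₁ q1 (by positivity) hM.le
  have q3 := mul_le_mul_of_nonneg_left q2 (show 0 ≤ lam / 32 by positivity)
  have q4 := mul_nonneg hlam hM.le
  linarith

set_option maxHeartbeats 800000 in
/-- At an interior maximum point of `bern` the second differences are not too large. -/
theorem CoefBounds.not_max_bern (hC : CoefBounds ell a b c f h K₀ K₃) {δ M : ℝ}
    (hδ : 0 < δ) (hh : 0 < h) (hh1 : h ≤ 1) (hK₀ : 0 ≤ K₀) (hK₃ : 0 ≤ K₃)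
    (hsplit : HasSplits ell) (hB : 1 ≤ B) (hM : cBig d₁ δ K₀ K₃ * B ≤ M)
    (hF : FunBounds ell h (cRatio d₁ δ K₀ * M) B (12 * (cRatio d₁ δ K₀ * M)) φ₀ x)
    {ν ζ : ℝ} (hζ : |ζ| ≤ B) (hρ : 0 ≤ ρ) (hν : cLam d₁ δ K₀ ≤ c x + ν)
    (hlap : ∀ σ ∈ triples ell, lap h (tetra σ) (oper ell a b c f h ρ ν ζ φ₀ φ₁) x ≤ 1)
    (hfd : ∀ j, fd h (ell j) (oper ell a b c f h ρ ν ζ φ₀ φ₁) x ≤ 1)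
    {π : Space d × Space d × Space d} (hπ : π ∈ triples ell)
    (hbig : M / 2 ≤ -lap h (tetra π) φ₀ x)
    (hmax : jump ell a b h ρ
      (bern ell h (cRatio d₁ δ K₀ * M) B (cEps d₁ δ K₀ / (cRatio d₁ δ K₀ * M))
        ((K₃ ^ 2 + 1) / M) π φ₀)
      (bern ell h (cRatio d₁ δ K₀ * M) B (cEps d₁ δ K₀ / (cRatio d₁ δ K₀ * M))
        ((K₃ ^ 2 + 1) / M) π φ₁) x ≤ 0) : False := by
  obtain ⟨m1, m2, m3, m4, -⟩ := cBig_spec hδ hK₀ hK₃ hB hM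
  have hr := one_le_cRatio (d₁ := d₁) hδ hK₀
  have hε := cEps_pos (d₁ := d₁) hδ hK₀
  have hC1 := cErr_nonneg (d₁ := d₁) hδ hK₀
  have hC2 := one_le_cErrFirst (d₁ := d₁) hδ hK₀ hK₃
  have hεr : cEps d₁ δ K₀ * (16 * (2 * d₁ + 1) ^ 3 * cRatio d₁ δ K₀) = 1 := cEps_mul hδ hK₀
  have hC1d : cErr d₁ δ K₀ = 2 + 2 * d₁ * (3 * K₀ * cRatio d₁ δ K₀ + 9 / 2 * (2 * d₁ + 1)
    + 4 * (K₀ ^ 2 * (6 * (12 * (2 * d₁ + 1) * (K₀ ^ 2 + 1) * cRatio d₁ δ K₀ / cEps d₁ δ K₀))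
      + 2 * K₀ ^ 3 * cRatio d₁ δ K₀)
    + 4 * (K₀ ^ 2 * (12 * cRatio d₁ δ K₀))) := rfl
  have hC2d : cErrFirst d₁ δ K₀ K₃ =
    1 + 2 * d₁ * (K₀ ^ 2 * (√K₀ + K₀) * cRatio d₁ δ K₀ + K₀ ^ 2) + (K₃ * K₀ + K₃) := rfl
  rw [cLam] at hν
  generalize cEps d₁ δ K₀ = ε at *
  generalize cRatio d₁ δ K₀ = r at *
  generalize cErr d₁ δ K₀ = C₁ at *
  generalize cErrFirst d₁ δ K₀ K₃ = C₂ at *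
  have hM0 : 0 < M := by linarith
  have hn : (0 : ℝ) ≤ 2 * d₁ := by positivity
  have G1 := hC.goodSecond_nonneg hh φ₀ x
  have G2 := hC.goodFirst_nonneg hh φ₀ x
  have hμ : 0 < K₃ ^ 2 + 1 := by positivity
  -- The Young parameters are chosen so that, summed over the `2 d₁` directions, the errors consume
  -- at most half of each quadratic term of `bern`. The errors then enter twice, once for `z_π` and
  -- once through `absorb_second`, which uses up exactly the whole.
  set θ₁ : ℝ := ε / (48 * (2 * d₁ + 1) * (K₀ ^ 2 + 1) * (r * M)) with hθ₁
  set θ₂ : ℝ := (K₃ ^ 2 + 1) / (2 * (2 * d₁ + 1) * M) with hθ₂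
  have hθ₁p : 0 < θ₁ := by positivity
  have hθ₂p : 0 < θ₂ := by positivity
  have i1 : 1 / (4 * θ₁) = 12 * (2 * d₁ + 1) * (K₀ ^ 2 + 1) * r / ε * M := by
    rw [hθ₁]
    field_simp
    ring
  have i2 : (3 * K₃) ^ 2 / (4 * θ₂) ≤ 9 / 2 * (2 * d₁ + 1) * M := by
    rw [div_le_iff₀ (by positivity)]
    have : 9 / 2 * (2 * d₁ + 1) * M * (4 * θ₂) = 9 * (K₃ ^ 2 + 1) := by
      rw [hθ₂]
      field_simp
      ring
    rw [this]
    linarith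
  have i3 : 2 * d₁ * (4 * (K₀ ^ 2 * (6 * θ₁))) ≤ ε / (r * M) / 2 := by
    have e : ε / (r * M) / 2 = 24 * (2 * d₁ + 1) * (K₀ ^ 2 + 1) * θ₁ := by
      rw [hθ₁]
      field_simp
      ring
    rw [e]
    have t1 : (2 * d₁ : ℝ) * K₀ ^ 2 ≤ (2 * d₁ + 1) * (K₀ ^ 2 + 1) := by gcongr <;> linarith
    have := mul_le_mul_of_nonneg_right t1 (show 0 ≤ 24 * θ₁ by positivity)
    linarith
  have i4 : 2 * d₁ * θ₂ ≤ (K₃ ^ 2 + 1) / M / 2 := by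
    have e : (K₃ ^ 2 + 1) / M / 2 = (2 * d₁ + 1) * θ₂ := by
      rw [hθ₂]
      field_simp
    rw [e]
    gcongr
    linarith
  set E : ℝ := C₁ * M + ε / (r * M) / 2 * goodSecond ell a b h φ₀ x
    + (K₃ ^ 2 + 1) / M / 2 * goodFirst ell a b h φ₀ x with hE
  have hE0 : 0 ≤ E := by positivity
  have hz : ∀ σ ∈ triples ell, jump ell a b h ρ (lap h (tetra σ) φ₀) (lap h (tetra σ) φ₁) x
      ≤ (c x + ν) * lap h (tetra σ) φ₀ x + E := by
    intro σ hσ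
    have key := hC.jump_lap_le hh hK₀ hK₃ hsplit hθ₁p hθ₂p hF hζ hσ (hlap σ hσ)
    rw [i1] at key
    have j2 := mul_le_mul_of_nonneg_left i2 hn
    have j3 := mul_le_mul_of_nonneg_right i3 G1
    have j4 := mul_le_mul_of_nonneg_right i4 G2
    have hE' : E = (2 + 2 * d₁ * (3 * K₀ * r + 9 / 2 * (2 * d₁ + 1)
      + 4 * (K₀ ^ 2 * (6 * (12 * (2 * d₁ + 1) * (K₀ ^ 2 + 1) * r / ε)) + 2 * K₀ ^ 3 * r)
      + 4 * (K₀ ^ 2 * (12 * r)))) * M + ε / (r * M) / 2 * goodSecond ell a b h φ₀ x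
      + (K₃ ^ 2 + 1) / M / 2 * goodFirst ell a b h φ₀ x := by rw [hE, hC1d]
    rw [hE']
    generalize 12 * (2 * d₁ + 1) * (K₀ ^ 2 + 1) * r / ε = w at *
    linarith
  set E' : ℝ := C₂ * M with hE'
  have hs : ∀ j, jump ell a b h ρ (fd h (ell j) φ₀) (fd h (ell j) φ₁) x
      ≤ (c x + ν) * fd h (ell j) φ₀ x + E' := by
    intro j
    have key := hC.jump_fd_le hh hh1 hK₀ hK₃ hF hζ (ell_mem_dirs j) (hfd j)
    have hBM : B ≤ M := by linarith
    have j1 := mul_le_mul_of_nonneg_left hBM (show 0 ≤ 2 * d₁ * K₀ ^ 2 by positivity)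
    have j2 := mul_le_mul_of_nonneg_left hBM (show 0 ≤ K₃ * K₀ + K₃ by positivity)
    have j3 : E' = (1 + 2 * d₁ * (K₀ ^ 2 * (√K₀ + K₀) * r + K₀ ^ 2) + (K₃ * K₀ + K₃)) * M := by
      rw [hE', hC2d]
    rw [j3]
    linarith
  have hlam : 0 ≤ c x + ν := by linarith
  have fin := jump_bern_ge (a := a) (b := b) hρ (p := ε / (r * M)) (q := (K₃ ^ 2 + 1) / M)
    (by positivity) (by positivity) hlam hE0
    (show 0 ≤ E' by positivity) (show 0 ≤ r * M by positivity) hπ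
    (fun σ hσ => hF.lap_le_self hσ) (fun j => hF.fd_le_self (ell_mem_dirs j)) hz hs
  have fin := fin.trans hmax
  generalize c x + ν = lam at *
  have k1 := absorb_second hlam hM0 hr hεr hE0
  have k2 := absorb_first hM0 hlam (by linarith) (by linarith) m4 m3
  have k3 := mul_le_mul_of_nonneg_left hbig hlam
  have k4 : (8 * C₁ + 5) * M ≤ lam * M := mul_le_mul_of_nonneg_right hν hM0.le
  rw [hE] at fin k1
  -- After cancellation, `λ M / 2 - 2 (λ M / 8) ≤ (2 C₁ + 1) M`, so `λ ≤ 8 C₁ + 4`, against `λ ≥ 8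
  -- C₁ + 5`.
  linarith

end Bernstein

/-! ### The exponential time weight. -/

section Time

variable {m T τ t : ℝ}

theorem xi_pos : 0 < xi m T τ t := by
  unfold xi
  split_ifs <;> exact Real.exp_pos _

theorem xi_zero (hT : 0 < T) : xi m T τ 0 = 1 := by
  simp [xi, hT]

theorem Tprime_eq {n : ℕ} (hτ : 0 < τ) (hn : n * τ < T) (hn' : T ≤ (n + 1) * τ) :
    Tprime T τ = (n + 1) * τ := by
  have e : sInf {n : ℕ | 1 ≤ n ∧ T ≤ n * τ} = n + 1 := by
    refine le_antisymm (Nat.sInf_le ⟨by omega, by exact_mod_cast hn'⟩)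
      (le_csInf ⟨n + 1, by omega, by exact_mod_cast hn'⟩ ?_)
    rintro k ⟨-, hk⟩
    by_contra hc
    have h1 : (k : ℝ) ≤ n := by exact_mod_cast (by omega : k ≤ n)
    have := mul_le_mul_of_nonneg_right h1 hτ.le
    linarith
  rw [Tprime, e]
  push_cast
  ring

theorem Tprime_le (hT : 0 < T) (hτ : 0 < τ) : Tprime T τ ≤ T + τ := by
  have h0 : 0 < T / τ := div_pos hT hτ
  have h1 : sInf {n : ℕ | 1 ≤ n ∧ T ≤ n * τ} ≤ ⌈T / τ⌉₊ :=
    Nat.sInf_le ⟨Nat.ceil_pos.2 h0, by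
      rw [← div_le_iff₀ hτ]
      exact Nat.le_ceil _⟩
  have h2 : ((sInf {n : ℕ | 1 ≤ n ∧ T ≤ n * τ} : ℕ) : ℝ) ≤ T / τ + 1 :=
    (Nat.cast_le.2 h1).trans (Nat.ceil_lt_add_one h0.le).le
  calc Tprime T τ ≤ (T / τ + 1) * τ := mul_le_mul_of_nonneg_right h2 hτ.le
    _ = T + τ := by field_simp

/-- Defining `ξ(T)` through `T'` makes the truncated last step multiply the weight by the same
factor `e^{mτ}` as a full step. -/
theorem xi_next (hτ : 0 < τ) (ht : t ∈ range fun n : ℕ => min (n * τ) T) (htT : t < T) :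
    xi m T τ (t + tauT T τ t) = Real.exp (m * τ) * xi m T τ t := by
  obtain ⟨n, rfl⟩ := ht
  have hn : n * τ < T := by
    rcases min_lt_iff.1 htT with h | h
    · exact h
    · exact absurd h (lt_irrefl T)
  simp only [min_eq_left hn.le]
  rw [xi, xi, if_pos hn, tauT, max_eq_left (by linarith)]
  by_cases h1 : (n + 1) * τ < T
  · rw [min_eq_left (by linarith), if_pos (by linarith), ← Real.exp_add]
    ring_nf
  · rw [min_eq_right (by linarith), if_neg (by linarith), Tprime_eq hτ hn (not_lt.1 h1),
      ← Real.exp_add]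
    ring_nf

theorem xi_le (hT : 0 < T) (hτ : 0 < τ) (ht : 0 ≤ t) (htT : t ≤ T) :
    xi m T τ t ≤ Real.exp (max m 0 * (T + τ)) := by
  have key : ∀ s, 0 ≤ s → s ≤ T + τ → m * s ≤ max m 0 * (T + τ) := fun s hs hs' =>
    mul_le_mul (le_max_left _ _) hs' hs (le_max_right _ _)
  unfold xi
  split_ifs
  · exact Real.exp_le_exp.2 (key t ht (by linarith))
  · exact Real.exp_le_exp.2 (key _ (by unfold Tprime; positivity) (Tprime_le hT hτ))

theorem xi_le_mul_xiMinus (hT : 0 < T) (hτ : 0 < τ) (ht : 0 ≤ t) (htT : t ≤ T) :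
    xi m T τ t ≤ Real.exp (max m 0 * (T + τ)) * xiMinus m T τ t := by
  rw [xiMinus]
  rcases le_total (xi m T τ t) 1 with h | h
  · rw [min_eq_left h]
    refine le_mul_of_one_le_left xi_pos.le (Real.one_le_exp ?_)
    have := le_max_right m 0
    positivity
  · rw [min_eq_right h, mul_one]
    exact xi_le hT hτ ht htT

theorem xiMinus_nonneg : 0 ≤ xiMinus m T τ t := le_min xi_pos.le zero_le_one

end Time

/-! ### Maxima over finite sets. -/

section MaxOn

variable {X : Type*} {S : Set X} {g : X → ℝ}

theorem le_maxOn (hS : S.Finite) {z : X} (hz : z ∈ S) : g z ≤ maxOn S g :=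
  le_csSup (hS.image g).bddAbove ⟨z, hz, rfl⟩

theorem maxOn_nonneg (hg : ∀ z, 0 ≤ g z) : 0 ≤ maxOn S g := by
  refine Real.sSup_nonneg ?_
  rintro _ ⟨z, -, rfl⟩
  exact hg z

end MaxOn

/-! ### Passing from the data in `R` to bounds for `ξ u`. -/

section Grid

variable {A : Type*} {d d₁ : ℕ} {D : Data A d d₁} {m T τ h η : ℝ} {l : Space d}
  {Q : Set (ℝ × Space d)} {u : ℝ → Space d → ℝ}

theorem finite_barQ (hQ : Q.Finite) : (barQ T τ Q).Finite := by
  refine hQ.union ((hQ.image fun y => (y.1 + tauT T τ y.1, y.2)).subset ?_)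
  rintro z ⟨y, hy, -, rfl⟩
  exact ⟨y, hy, rfl⟩

theorem time_mem_of_mem_grid (hQ : Q ⊆ grid D T τ h η l) {z : ℝ × Space d} (hz : z ∈ Q) :
    z.1 ∈ (range fun n : ℕ => min (n * τ) T) ∧ 0 ≤ z.1 ∧ z.1 < T :=
  ⟨(hQ hz).1.1, (hQ hz).2.1.1, (hQ hz).2.1.2⟩

theorem time_mem_of_mem_barQ (hT : 0 < T) (hQ : Q ⊆ grid D T τ h η l) {z : ℝ × Space d}
    (hz : z ∈ barQ T τ Q) : 0 ≤ z.1 ∧ z.1 ≤ T := by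
  rcases hz with hz | ⟨y, -, hy, rfl⟩
  · exact ⟨(time_mem_of_mem_grid hQ hz).2.1, (time_mem_of_mem_grid hQ hz).2.2.le⟩
  · simp only [hy]
    exact ⟨hT.le, le_rfl⟩

theorem fd_const_mul (s : ℝ) (φ : Space d → ℝ) (e x : Space d) :
    fd h e (fun y => s * φ y) x = s * fd h e φ x := by
  simp only [fd]
  ring

/-- The right-hand side of the estimate, without the constant. -/
def dataBound (D : Data A d d₁) (m T τ h : ℝ) (Q : Set (ℝ × Space d)) (u : ℝ → Space d → ℝ) : ℝ :=
  Real.exp (max m 0 * (T + τ)) * R D m T τ h Q u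

/-- The function `ξ u`. -/
def weighted (m T τ : ℝ) (u : ℝ → Space d → ℝ) (t : ℝ) (x : Space d) : ℝ := xi m T τ t * u t x

theorem abs_xi_mul_le (hT : 0 < T) (hτ : 0 < τ) {t : ℝ} (ht : 0 ≤ t) (htT : t ≤ T) {w r : ℝ}
    (hw : |xiMinus m T τ t * w| ≤ r) :
    |xi m T τ t * w| ≤ Real.exp (max m 0 * (T + τ)) * r := by
  rw [abs_mul, abs_of_pos xi_pos]
  rw [abs_mul, abs_of_nonneg xiMinus_nonneg] at hw
  calc _ ≤ Real.exp (max m 0 * (T + τ)) * xiMinus m T τ t * |w| := by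
        gcongr
        exact xi_le_mul_xiMinus hT hτ ht htT
    _ ≤ _ := by
        rw [mul_assoc]
        gcongr

/-- The bounds contained in `dataBound`. -/
structure WeightedBounds (D : Data A d d₁) (m T τ h : ℝ) (Q : Set (ℝ × Space d))
    (u : ℝ → Space d → ℝ) (B : ℝ) : Prop where
  one_le : 1 ≤ B
  xi_le : ∀ z ∈ barQ T τ Q, xi m T τ z.1 ≤ B
  val_le : ∀ z ∈ barQ T τ Q, |weighted m T τ u z.1 z.2| ≤ B
  td_ge : ∀ z ∈ Q, -B ≤ xi m T τ z.1 * td T τ u z.1 z.2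
  fd_le : ∀ z ∈ barQ T τ Q, ∀ y ∈ dirs D.ell, |fd h y (weighted m T τ u z.1) z.2| ≤ B
  mixed_le : ∀ z ∈ boundary₂ D T τ h Q, ∀ y ∈ dirs D.ell, ∀ y' ∈ dirs D.ell,
    |fd h y (fd h y' (weighted m T τ u z.1)) z.2| ≤ B

/-- `R` is weighted with `ξ ∧ 1`, while the argument uses `ξ`. The ratio is at most `e^{m⁺(T+τ)}`,
the source of this factor in the estimate. -/
theorem weightedBounds (hT : 0 < T) (hτ : 0 < τ) (hfin : Q.Finite)
    (hQ : Q ⊆ grid D T τ h η l) :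
    WeightedBounds D m T τ h Q u (dataBound D m T τ h Q u) := by
  have hfb : (barQ T τ Q).Finite := finite_barQ hfin
  have hexp : 1 ≤ Real.exp (max m 0 * (T + τ)) := Real.one_le_exp (by
    have := le_max_right m 0
    positivity)
  have r₁ : 0 ≤ maxOn (barQ T τ Q) (fun z => |xiMinus m T τ z.1 * u z.1 z.2|) :=
    maxOn_nonneg fun _ => abs_nonneg _
  have r₂ : 0 ≤ maxOn Q (fun z => max (-(xiMinus m T τ z.1 * td T τ u z.1 z.2)) 0) :=
    maxOn_nonneg fun _ => le_max_right _ _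
  have r₃ : 0 ≤ maxOn (boundary₂ D T τ h Q ×ˢ (univ : Set (Idx d₁ × Idx d₁))) (fun w =>
      |xiMinus m T τ w.1.1 * fd h (D.ell w.2.1) (fd h (D.ell w.2.2) (u w.1.1)) w.1.2|) :=
    maxOn_nonneg fun _ => abs_nonneg _
  have r₄ : 0 ≤ maxOn (barQ T τ Q ×ˢ (univ : Set (Idx d₁))) (fun w =>
      |xiMinus m T τ w.1.1 * fd h (D.ell w.2) (u w.1.1) w.1.2|) :=
    maxOn_nonneg fun _ => abs_nonneg _
  have hR : 1 ≤ R D m T τ h Q u := by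
    rw [R]
    linarith
  have hB1 : 1 ≤ dataBound D m T τ h Q u := one_le_mul_of_one_le_of_one_le hexp hR
  have hB0 : 0 ≤ dataBound D m T τ h Q u := by linarith
  have htime : ∀ z ∈ barQ T τ Q, 0 ≤ z.1 ∧ z.1 ≤ T := fun z hz => time_mem_of_mem_barQ hT hQ hz
  have hbd : boundary₂ D T τ h Q ⊆ barQ T τ Q := sdiff_subset
  refine ⟨hB1, fun z hz => ?_, fun z hz => ?_, fun z hz => ?_, fun z hz y hy => ?_,
    fun z hz y hy y' hy' => ?_⟩
  · exact (xi_le hT hτ (htime z hz).1 (htime z hz).2).trans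
      (le_mul_of_one_le_right (by positivity) hR)
  · refine abs_xi_mul_le hT hτ (htime z hz).1 (htime z hz).2 ?_
    have := le_maxOn (g := fun z => |xiMinus m T τ z.1 * u z.1 z.2|) hfb hz
    rw [R]
    linarith
  · obtain ⟨h1, h2⟩ := htime z (Or.inl hz)
    have h3 := xi_le_mul_xiMinus (m := m) hT hτ h1 h2
    have h4 := le_maxOn (g := fun z => max (-(xiMinus m T τ z.1 * td T τ u z.1 z.2)) 0) hfin hz
    have h5 := le_max_left (-(xiMinus m T τ z.1 * td T τ u z.1 z.2)) 0
    have h6 : -(xiMinus m T τ z.1 * td T τ u z.1 z.2) ≤ R D m T τ h Q u := by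
      rw [R]
      linarith
    rcases le_total 0 (td T τ u z.1 z.2) with h7 | h7
    · have := mul_nonneg (xi_pos (m := m) (T := T) (τ := τ) (t := z.1)).le h7
      linarith
    · have h8 := mul_le_mul_of_nonneg_right h3 (neg_nonneg.2 h7)
      have h9 := mul_le_mul_of_nonneg_left h6 (show 0 ≤ Real.exp (max m 0 * (T + τ)) by positivity)
      rw [dataBound]
      linarith
  · rcases mem_dirs.1 hy with rfl | ⟨k, rfl⟩
    · simpa [fd_zero] using hB0
    unfold weighted
    rw [fd_const_mul]
    refine abs_xi_mul_le hT hτ (htime z hz).1 (htime z hz).2 ?_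
    have := le_maxOn (g := fun w : (ℝ × Space d) × Idx d₁ =>
      |xiMinus m T τ w.1.1 * fd h (D.ell w.2) (u w.1.1) w.1.2|) (hfb.prod (finite_univ))
      (z := (z, k)) ⟨hz, mem_univ _⟩
    rw [R]
    linarith
  · rcases mem_dirs.1 hy with rfl | ⟨k, rfl⟩
    · simpa [fd_zero] using hB0
    rcases mem_dirs.1 hy' with rfl | ⟨k', rfl⟩
    · rw [fd_comm]
      simpa [fd_zero] using hB0
    have e : fd h (D.ell k') (weighted m T τ u z.1)
        = fun y => xi m T τ z.1 * fd h (D.ell k') (u z.1) y := by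
      funext y
      unfold weighted
      rw [fd_const_mul]
    rw [e, fd_const_mul]
    refine abs_xi_mul_le hT hτ (htime z (hbd hz)).1 (htime z (hbd hz)).2 ?_
    have := le_maxOn (g := fun w : (ℝ × Space d) × (Idx d₁ × Idx d₁) =>
      |xiMinus m T τ w.1.1 * fd h (D.ell w.2.1) (fd h (D.ell w.2.2) (u w.1.1)) w.1.2|)
      ((hfb.subset hbd).prod (finite_univ)) (z := (z, (k, k'))) ⟨hz, mem_univ _⟩
    rw [R]
    linarith

end Grid

/-! ### The equation for the weighted function. -/

section Equation

variable {A : Type*} {d d₁ : ℕ} {D : Data A d d₁} {m T τ h : ℝ} {u : ℝ → Space d → ℝ}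

/-- The expression under the supremum in the equation. -/
def expr (D : Data A d d₁) (T τ h : ℝ) (u : ℝ → Space d → ℝ) (t : ℝ) (x : Space d) (α : A) : ℝ :=
  D.r α t * td T τ u t x
      + ∑ k, (D.a α k t x * sd h (D.ell k) (u t) x + D.b α k t x * fd h (D.ell k) (u t) x)
      - D.c α t x * u t x + D.f α t x

/-- The equation in terms of `ξ u`. -/
theorem oper_weighted {t : ℝ} (hτ : 0 < τ) (ht : t ∈ range fun n : ℕ => min (n * τ) T)
    (htT : t < T) (α : A) (x : Space d) :
    oper D.ell (fun k => D.a α k t) (fun k => D.b α k t) (D.c α t) (D.f α t) h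
        (D.r α t * Real.exp (-m * τ) / τ) (D.r α t * cm m τ) (xi m T τ t)
        (weighted m T τ u t) (weighted m T τ u (t + tauT T τ t)) x
      = xi m T τ t * expr D T τ h u t x α := by
  have e : ∀ k, D.a α k t x * sd h (D.ell k) (weighted m T τ u t) x
      + D.b α k t x * fd h (D.ell k) (weighted m T τ u t) x
      = xi m T τ t * (D.a α k t x * sd h (D.ell k) (u t) x
        + D.b α k t x * fd h (D.ell k) (u t) x) := by
    intro k
    simp only [sd, fd, weighted]
    ring
  -- The time difference of `u` becomes a jump of rate `r e^{-mτ}/τ` for `ξ u`, and the excess `r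
  -- c_m` joins the zeroth-order coefficient.
  have e₂ : Real.exp (-m * τ) * Real.exp (m * τ) = 1 := by
    rw [← Real.exp_add]
    simp
  simp only [oper, e, ← Finset.mul_sum]
  rw [expr, td, cm, weighted, weighted, xi_next hτ ht htT]
  have e₃ : D.r α t * Real.exp (-m * τ) / τ * (Real.exp (m * τ) * xi m T τ t
        * u (t + tauT T τ t) x - xi m T τ t * u t x)
      = (Real.exp (-m * τ) * Real.exp (m * τ)) * (D.r α t / τ * xi m T τ t * u (t + tauT T τ t) x)
        - D.r α t * Real.exp (-m * τ) / τ * xi m T τ t * u t x := by ring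
  rw [e₃, e₂]
  ring

theorem lam_le {K₃ : ℝ} (hr : ∀ α t, 0 ≤ D.r α t) (hr' : ∀ α t, D.r α t ≤ K₃)
    (hc : ∀ α t x, |D.c α t x| ≤ K₃) (α : A) (t : ℝ) (x : Space d) :
    lam D m τ ≤ D.c α t x + D.r α t * cm m τ := by
  -- An infimum of reals is a lower bound only if the family is bounded below; the bounds on `c` and
  -- `r` supply this.
  refine ciInf_le (f := fun p : A × ℝ × Space d =>
    D.c p.1 p.2.1 p.2.2 + D.r p.1 p.2.1 * cm m τ) ⟨-K₃ - K₃ * |cm m τ|, ?_⟩ (α, t, x)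
  rintro _ ⟨⟨α, t, x⟩, rfl⟩
  have h1 := (abs_le.1 (hc α t x)).1
  have h2 := mul_le_mul_of_nonneg_left (neg_abs_le (cm m τ)) (hr α t)
  have h3 := mul_le_mul_of_nonneg_right (hr' α t) (abs_nonneg (cm m τ))
  simp only
  linarith

end Equation

/-! ### Two-sided bounds from the equation, and the maximum principle. -/

section Estimate

variable {A : Type*} {d d₁ : ℕ} {D : Data A d d₁} {T τ h η m h₀ δ K₀ K₃ B M : ℝ} {l : Space d}
  {Q : Set (ℝ × Space d)} {u : ℝ → Space d → ℝ}

/-- The hypotheses of the estimate, with the data bounded by `B`. -/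
structure Problem [TopologicalSpace A] (D : Data A d d₁) (T τ h η m h₀ δ K₀ K₃ B : ℝ)
    (l : Space d) (Q : Set (ℝ × Space d)) (u : ℝ → Space d → ℝ) : Prop where
  T_pos : 0 < T
  τ_pos : 0 < τ
  h_pos : 0 < h
  δ_pos : 0 < δ
  δ_le : δ ≤ 1
  K₀_nonneg : 0 ≤ K₀
  K₃_nonneg : 0 ≤ K₃
  basic : Basic D K₀ K₃
  rootLip : RootLipschitz D K₀
  monotone : Monotone D h₀
  second : SecondDiffs D h η l K₀ K₃
  nondeg : Nondegenerate D δ K₀ K₃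
  splits : ∃ d₀, Splits D d₀
  finite : Q.Finite
  subset : Q ⊆ grid D T τ h η l
  solves : ∀ z ∈ Q, SolvesAt D T τ h u z.1 z.2
  bounds : WeightedBounds D m T τ h Q u B

theorem mem_interior_or_boundary {z : ℝ × Space d} (hz : z ∈ barQ T τ Q) :
    z ∈ interior₂ D T τ h Q ∨ z ∈ boundary₂ D T τ h Q := by
  by_cases hi : z ∈ interior₂ D T τ h Q
  · exact Or.inl hi
  · exact Or.inr ⟨hz, hi⟩

variable [TopologicalSpace A]

theorem Problem.hasSplits (P : Problem D T τ h η m h₀ δ K₀ K₃ B l Q u) : HasSplits D.ell := by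
  obtain ⟨d₀, hS⟩ := P.splits
  exact fun y hy k hk => hS.exists_split P.basic.ell_opp hy hk

/-- The interior is defined by double steps, but every direction is itself a sum of two, so single
steps also stay in `Q`. -/
theorem Problem.shift_mem (P : Problem D T τ h η m h₀ δ K₀ K₃ B l Q u) {z : ℝ × Space d}
    (hz : z ∈ interior₂ D T τ h Q) {y : Space d} (hy : y ∈ dirs D.ell) :
    (z.1, z.2 + h • y) ∈ Q := by
  rcases mem_dirs.1 hy with rfl | ⟨k, rfl⟩
  · simpa using hz.1
  obtain ⟨d₀, hS⟩ := P.splits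
  obtain ⟨i, j, hij⟩ := hS.exists_add P.basic.ell_opp k
  have := hz.2.2.2 _ ⟨i, rfl⟩ _ ⟨j, rfl⟩
  rwa [hij, smul_add, ← add_assoc]

theorem Problem.abs_lap_boundary_le (P : Problem D T τ h η m h₀ δ K₀ K₃ B l Q u)
    {z : ℝ × Space d} (hz : z ∈ boundary₂ D T τ h Q) {σ : Space d × Space d × Space d}
    (hσ : σ ∈ triples D.ell) : |lap h (tetra σ) (weighted m T τ u z.1) z.2| ≤ 3 * B :=
  abs_lap_tetra_le P.basic.ell_opp (P.bounds.mixed_le z hz) hσ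

theorem Problem.expr_le (P : Problem D T τ h η m h₀ δ K₀ K₃ B l Q u) {z : ℝ × Space d}
    (hz : z ∈ Q) (α : A) : expr D T τ h u z.1 z.2 α ≤ 0 :=
  (P.solves z hz).1 ⟨α, rfl⟩

/-- The upper bound for `a_k Δ_k` which follows from the equation. -/
theorem Problem.a_mul_sd_le (P : Problem D T τ h η m h₀ δ K₀ K₃ B l Q u)
    (hM : cBig d₁ δ K₀ K₃ * B ≤ M) {z : ℝ × Space d} (hz : z ∈ Q)
    (hlow : ∀ k, -M ≤ sd h (D.ell k) (weighted m T τ u z.1) z.2) (α : A) (k : Idx d₁) :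
    D.a α k z.1 z.2 * sd h (D.ell k) (weighted m T τ u z.1) z.2 ≤ (2 * d₁ * K₀ + 1) * M := by
  have hzb : z ∈ barQ T τ Q := Or.inl hz
  have hK₃ := P.K₃_nonneg
  obtain ⟨hB16, -, -, -, m5⟩ := cBig_spec P.δ_pos P.K₀_nonneg hK₃ P.bounds.one_le hM
  have hB1 := P.bounds.one_le
  have hM0 : 0 ≤ M := by linarith
  have hξ := xi_pos (m := m) (T := T) (τ := τ) (t := z.1)
  have hξB := P.bounds.xi_le z hzb
  have key := mul_nonpos_of_nonneg_of_nonpos hξ.le (P.expr_le hz α)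
  set w : Idx d₁ → ℝ := fun j => sd h (D.ell j) (weighted m T τ u z.1) z.2 with hw
  set s : Idx d₁ → ℝ := fun j => fd h (D.ell j) (weighted m T τ u z.1) z.2 with hs
  have e : ∀ j, xi m T τ z.1 * (D.a α j z.1 z.2 * sd h (D.ell j) (u z.1) z.2
      + D.b α j z.1 z.2 * fd h (D.ell j) (u z.1) z.2)
      = D.a α j z.1 z.2 * w j + D.b α j z.1 z.2 * s j := by
    intro j
    simp only [hw, hs, sd, fd, weighted]
    ring
  have e₂ : xi m T τ z.1 * expr D T τ h u z.1 z.2 α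
      = D.r α z.1 * (xi m T τ z.1 * td T τ u z.1 z.2)
        + ∑ j, (D.a α j z.1 z.2 * w j + D.b α j z.1 z.2 * s j)
        - D.c α z.1 z.2 * weighted m T τ u z.1 z.2 + xi m T τ z.1 * D.f α z.1 z.2 := by
    rw [← Finset.sum_congr rfl fun j _ => e j, ← Finset.mul_sum, expr, weighted]
    ring
  rw [e₂] at key
  -- Because `r ≥ 0`, only the negative part of the time difference is needed.
  have b₁ : -(K₃ * B) ≤ D.r α z.1 * (xi m T τ z.1 * td T τ u z.1 z.2) := by
    have h1 := mul_le_mul_of_nonneg_left (P.bounds.td_ge z hz) (P.basic.r_nonneg α z.1)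
    have h2 := mul_le_mul_of_nonneg_right (P.nondeg.r_le α z.1) (by linarith : 0 ≤ B)
    linarith
  have b₂ : |D.c α z.1 z.2 * weighted m T τ u z.1 z.2| ≤ K₃ * B := by
    rw [abs_mul]
    exact mul_le_mul (P.nondeg.c_le α _ _) (P.bounds.val_le z hzb) (abs_nonneg _) hK₃
  have b₃ : |xi m T τ z.1 * D.f α z.1 z.2| ≤ K₃ * B := by
    rw [abs_mul, abs_of_pos hξ, mul_comm]
    exact mul_le_mul (P.nondeg.f_le α _ _) hξB hξ.le hK₃
  -- All other second-order terms are at least `-K₀ M`, so the one with index `k` cannot be large.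
  have b₄ : D.a α k z.1 z.2 * w k - 2 * d₁ * (K₀ * M + K₃ * B)
      ≤ ∑ j, (D.a α j z.1 z.2 * w j + D.b α j z.1 z.2 * s j) := by
    have c1 : ∀ j, 0 ≤ D.a α j z.1 z.2 * w j + K₀ * M := by
      intro j
      have h1 := mul_le_mul_of_nonneg_left (hlow j) (P.basic.a_nonneg α j z.1 z.2)
      have h2 := mul_le_mul_of_nonneg_right (P.nondeg.a_le α j z.1 z.2) hM0
      simp only [hw]
      linarith
    have c2 : ∀ j, 0 ≤ D.b α j z.1 z.2 * s j + K₃ * B := by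
      intro j
      have : |D.b α j z.1 z.2 * s j| ≤ K₃ * B := by
        rw [abs_mul]
        exact mul_le_mul (P.nondeg.b_le α j _ _) (P.bounds.fd_le z hzb _ (ell_mem_dirs j))
          (abs_nonneg _) hK₃
      linarith [(abs_le.1 this).1]
    have c3 := Finset.single_le_sum (f := fun j => (D.a α j z.1 z.2 * w j
      + D.b α j z.1 z.2 * s j) + (K₀ * M + K₃ * B)) (fun j _ => by linarith [c1 j, c2 j])
      (Finset.mem_univ k)
    rw [Finset.sum_add_distrib, Finset.sum_const, nsmul_eq_mul] at c3
    rw [card_univ_idx] at c3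
    have := c2 k
    have := mul_nonneg P.K₀_nonneg hM0
    linarith
  have b₂ := abs_le.1 b₂
  have b₃ := abs_le.1 b₃
  change D.a α k z.1 z.2 * w k ≤ _
  linarith [b₂.2, b₃.1]

/-- The bound on `a_k Δ_k` holds for every `α`, so it may be divided by `a_k` at an `α` with `a_k >
δ / 2`. No equation holds at points of `barQ` outside `Q`, but these belong to the boundary. -/
theorem Problem.sd_le (P : Problem D T τ h η m h₀ δ K₀ K₃ B l Q u)
    (hM : cBig d₁ δ K₀ K₃ * B ≤ M) [Nonempty A]
    {z : ℝ × Space d} (hz : z ∈ barQ T τ Q)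
    (hlow : ∀ σ ∈ triples D.ell, -M ≤ lap h (tetra σ) (weighted m T τ u z.1) z.2)
    {y : Space d} (hy : y ∈ dirs D.ell) :
    sd h y (weighted m T τ u z.1) z.2 ≤ 2 * (2 * d₁ * K₀ + 1) / δ * M := by
  obtain ⟨hB16, -⟩ := cBig_spec P.δ_pos P.K₀_nonneg P.K₃_nonneg P.bounds.one_le hM
  have hB1 := P.bounds.one_le
  have hK₀ := P.K₀_nonneg
  have hδ := P.δ_pos
  have hM0 : 0 ≤ M := by linarith
  have hW0 : 0 ≤ 2 * (2 * d₁ * K₀ + 1) / δ * M := by positivity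
  rcases mem_dirs.1 hy with rfl | ⟨k, rfl⟩
  · rwa [sd_zero]
  by_cases hzQ : z ∈ Q
  · have hlow' : ∀ k, -M ≤ sd h (D.ell k) (weighted m T τ u z.1) z.2 := fun k => by
      rw [← lap_pure]
      exact hlow _ (pure_mem_triples P.basic.ell_opp (ell_mem_dirs k))
    obtain ⟨α, hα⟩ := exists_lt_of_lt_ciSup
      (lt_of_lt_of_le (half_lt_self P.δ_pos) (P.nondeg.le_sup_a k z.1 z.2))
    have key := P.a_mul_sd_le hM hzQ hlow' α k
    rcases le_total (sd h (D.ell k) (weighted m T τ u z.1) z.2) 0 with h0 | h0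
    · exact h0.trans hW0
    · have h1 := mul_le_mul_of_nonneg_right hα.le h0
      rw [div_mul_eq_mul_div, le_div_iff₀ hδ]
      linarith
  · have hzb : z ∈ boundary₂ D T τ h Q := ⟨hz, fun hi => hzQ hi.1⟩
    have h1 := P.abs_lap_boundary_le hzb (pure_mem_triples P.basic.ell_opp hy)
    rw [lap_pure] at h1
    have h2 : 1 ≤ 2 * (2 * d₁ * K₀ + 1) / δ := by
      rw [le_div_iff₀ hδ]
      have : 0 ≤ 2 * d₁ * K₀ := by positivity
      linarith [P.δ_le]
    have h3 := mul_le_mul_of_nonneg_right h2 hM0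
    linarith [(abs_le.1 h1).2]

theorem Problem.abs_lap_le (P : Problem D T τ h η m h₀ δ K₀ K₃ B l Q u)
    (hM : cBig d₁ δ K₀ K₃ * B ≤ M) [Nonempty A] {z : ℝ × Space d} (hz : z ∈ barQ T τ Q)
    (hlow : ∀ σ ∈ triples D.ell, -M ≤ lap h (tetra σ) (weighted m T τ u z.1) z.2)
    {σ : Space d × Space d × Space d} (hσ : σ ∈ triples D.ell) :
    |lap h (tetra σ) (weighted m T τ u z.1) z.2| ≤ cRatio d₁ δ K₀ * M := by
  obtain ⟨hB16, -⟩ := cBig_spec P.δ_pos P.K₀_nonneg P.K₃_nonneg P.bounds.one_le hM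
  have hM0 : 0 ≤ M := by linarith [P.bounds.one_le]
  have hr := mul_le_mul_of_nonneg_right (one_le_cRatio (d₁ := d₁) P.δ_pos P.K₀_nonneg) hM0
  obtain ⟨p, q, s⟩ := σ
  obtain ⟨h1, h2, h3, h4, h5⟩ := mem_triples.1 hσ
  have e := lap_add_lap_neg (h := h) p q s (weighted m T τ u z.1) z.2
  have w₁ := P.sd_le hM hz hlow h1
  have w₂ := P.sd_le hM hz hlow h4
  have w₃ := P.sd_le hM hz hlow h2
  have w₄ := P.sd_le hM hz hlow h5
  have n := hlow _ (neg_mem_triples P.basic.ell_opp hσ)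
  have n' := hlow _ hσ
  have er : cRatio d₁ δ K₀ * M = 4 * (2 * (2 * d₁ * K₀ + 1) / δ * M) + M := by
    rw [cRatio]
    ring
  rw [abs_le]
  constructor <;> linarith

/-- The bound for all mixed second differences. -/
theorem Problem.abs_mixed_le (P : Problem D T τ h η m h₀ δ K₀ K₃ B l Q u)
    (hM : cBig d₁ δ K₀ K₃ * B ≤ M) [Nonempty A]
    (hlow : ∀ z ∈ barQ T τ Q, ∀ σ ∈ triples D.ell,
      -M ≤ lap h (tetra σ) (weighted m T τ u z.1) z.2)
    {z : ℝ × Space d} (hz : z ∈ barQ T τ Q) {y y' : Space d} (hy : y ∈ dirs D.ell)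
    (hy' : y' ∈ dirs D.ell) :
    |fd h y (fd h y' (weighted m T τ u z.1)) z.2| ≤ 12 * (cRatio d₁ δ K₀ * M) := by
  obtain ⟨hB16, -⟩ := cBig_spec P.δ_pos P.K₀_nonneg P.K₃_nonneg P.bounds.one_le hM
  have hB1 := P.bounds.one_le
  have hM0 : 0 ≤ M := by linarith
  have hr := mul_le_mul_of_nonneg_right (one_le_cRatio (d₁ := d₁) P.δ_pos P.K₀_nonneg) hM0
  obtain ⟨d₀, hS⟩ := P.splits
  set κ := cRatio d₁ δ K₀ * M with hκ
  have hκ0 : 0 ≤ κ := by linarith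
  have hopp := P.basic.ell_opp
  have hlapκ : ∀ z ∈ barQ T τ Q, ∀ σ ∈ triples D.ell,
      |lap h (tetra σ) (weighted m T τ u z.1) z.2| ≤ κ :=
    fun z hz σ hσ => P.abs_lap_le hM hz (hlow z hz) hσ
  have hsdκ : ∀ z ∈ barQ T τ Q, ∀ y ∈ dirs D.ell, |sd h y (weighted m T τ u z.1) z.2| ≤ κ := by
    intro z hz y hy
    rw [← lap_pure]
    exact hlapκ z hz _ (pure_mem_triples hopp hy)
  have short_short : ∀ z ∈ barQ T τ Q, ∀ i ∈ short D d₀, ∀ j ∈ short D d₀,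
      |fd h i (fd h j (weighted m T τ u z.1)) z.2| ≤ 3 * κ := by
    intro z hz i hi j hj
    have hi' := short_mem_dirs hi
    have hj' := short_mem_dirs hj
    rcases mem_interior_or_boundary (D := D) (h := h) hz with hz' | hz'
    -- The vector `2i` need not be a direction, so the repeated difference is read as a pure one
    -- centred at `x + h i`, still in `Q`.
    · by_cases hij : i = j
      · subst hij
        rw [fd_fd_self]
        have := hsdκ _ (Or.inl (P.shift_mem hz' hi')) i hi'
        simp only at this
        linarith
      · have hmem := hS.add_mem hi hj (Or.inl hij)
        rw [fd_fd_eq_lap]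
        have h1 := abs_le.1 (hlapκ z hz _ (mixed_mem_triples hopp hi' hj' hmem))
        have h2 := abs_le.1 (hsdκ z hz _ hi')
        have h3 := abs_le.1 (hsdκ z hz _ hj')
        rw [abs_le]
        constructor <;> linarith [h1.1, h1.2, h2.1, h2.2, h3.1, h3.2]
    · exact (P.bounds.mixed_le z hz' i hi' j hj').trans (by linarith)
  -- Writing a long direction as a sum of two short ones telescopes the difference and doubles the
  -- bound. Applied in each variable this gives `3 · 2 · 2 = 12`.
  have extend : ∀ (C : ℝ), 0 ≤ C → B ≤ 2 * C → ∀ j ∈ dirs D.ell,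
      (∀ z ∈ barQ T τ Q, ∀ i ∈ short D d₀,
        |fd h i (fd h j (weighted m T τ u z.1)) z.2| ≤ C) →
      ∀ z ∈ barQ T τ Q, ∀ i ∈ dirs D.ell,
        |fd h i (fd h j (weighted m T τ u z.1)) z.2| ≤ 2 * C := by
    intro C hC hBC j hj hC' z hz i hi
    rcases mem_interior_or_boundary (D := D) (h := h) hz with hz' | hz'
    · rcases mem_dirs.1 hi with rfl | ⟨i, rfl⟩
      · rw [fd_zero, abs_zero]
        linarith
      rcases hS.cases i with hi' | ⟨l₁, h₁, l₂, h₂, -, -, e⟩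
      · linarith [hC' z hz _ hi']
      · rw [e, fd_add_dir]
        have c1 := hC' _ (Or.inl (P.shift_mem hz' (short_mem_dirs h₂))) l₁ h₁
        have c2 := hC' z hz l₂ h₂
        simp only at c1
        refine (abs_add_le _ _).trans ?_
        linarith
    · exact (P.bounds.mixed_le z hz' i hi j hj).trans hBC
  have short_dirs : ∀ z ∈ barQ T τ Q, ∀ i ∈ short D d₀, ∀ j ∈ dirs D.ell,
      |fd h i (fd h j (weighted m T τ u z.1)) z.2| ≤ 2 * (3 * κ) := by
    intro z hz i hi j hj
    rw [fd_comm]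
    exact extend (3 * κ) (by linarith) (by linarith) i (short_mem_dirs hi)
      (fun z hz j hj => short_short z hz j hj i hi) z hz j hj
  refine (extend (2 * (3 * κ)) (by linarith) (by linarith) y' hy'
    (fun z hz i hi => short_dirs z hz i hi y' hy') z hz y hy).trans ?_
  linarith

theorem Problem.coef (P : Problem D T τ h η m h₀ δ K₀ K₃ B l Q u) (hh₀ : h ≤ h₀) (α : A) (t : ℝ) :
    CoefBounds D.ell (fun k => D.a α k t) (fun k => D.b α k t) (D.c α t) (D.f α t) h K₀ K₃ :=
  D.coefBounds P.K₀_nonneg P.K₃_nonneg P.h_pos hh₀ P.basic P.rootLip P.monotone P.second P.nondeg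
    α t

/-- The zero-sum second differences are bounded below by the data. -/
theorem Problem.lap_gt (P : Problem D T τ h η m h₀ δ K₀ K₃ B l Q u) [Nonempty A]
    (hh₀ : h ≤ h₀) (hh1 : h ≤ 1) (hlam : cLam d₁ δ K₀ ≤ lam D m τ) {z : ℝ × Space d}
    (hz : z ∈ barQ T τ Q) {σ : Space d × Space d × Space d} (hσ : σ ∈ triples D.ell) :
    -(cBig d₁ δ K₀ K₃ * B) < lap h (tetra σ) (weighted m T τ u z.1) z.2 := by
  by_contra! hcon
  have hfin : (barQ T τ Q ×ˢ (triples D.ell : Set (Space d × Space d × Space d))).Finite :=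
    (finite_barQ P.finite).prod (Finset.finite_toSet _)
  have hne : (barQ T τ Q ×ˢ (triples D.ell : Set (Space d × Space d × Space d))).Nonempty :=
    ⟨(z, σ), hz, hσ⟩
  obtain ⟨⟨z₁, π₁⟩, ⟨hz₁, hπ₁⟩, hmin⟩ := Set.exists_min_image _
    (fun p : (ℝ × Space d) × (Space d × Space d × Space d) =>
      lap h (tetra p.2) (weighted m T τ u p.1.1) p.1.2) hfin hne
  -- The minimum over points and quadruples together fixes `M`, so `-M` bounds all quadruples from
  -- below and the equation bounds them from above.
  set M : ℝ := -lap h (tetra π₁) (weighted m T τ u z₁.1) z₁.2 with hMdef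
  have hM : cBig d₁ δ K₀ K₃ * B ≤ M := by
    have := hmin (z, σ) ⟨hz, hσ⟩
    simp only at this
    linarith
  have hlow : ∀ z ∈ barQ T τ Q, ∀ σ ∈ triples D.ell,
      -M ≤ lap h (tetra σ) (weighted m T τ u z.1) z.2 := by
    intro z hz σ hσ
    rw [hMdef, neg_neg]
    exact hmin (z, σ) ⟨hz, hσ⟩
  have hB1 := P.bounds.one_le
  have hK₀ := P.K₀_nonneg
  have hK₃ := P.K₃_nonneg
  have hh := P.h_pos
  obtain ⟨m1, -, -, m4, -⟩ := cBig_spec P.δ_pos hK₀ hK₃ hB1 hM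
  have hM0 : 0 < M := by linarith
  have hr := one_le_cRatio (d₁ := d₁) P.δ_pos hK₀
  have hε := cEps_pos (d₁ := d₁) P.δ_pos hK₀
  have hεr := cEps_mul (d₁ := d₁) P.δ_pos hK₀
  set κ := cRatio d₁ δ K₀ * M with hκ
  have hκ0 : 0 < κ := by positivity
  set p := cEps d₁ δ K₀ / κ with hp
  set q := (K₃ ^ 2 + 1) / M with hq
  have hp0 : 0 ≤ p := by positivity
  have hq0 : 0 ≤ q := by positivity
  have hlapκ : ∀ z ∈ barQ T τ Q, ∀ σ ∈ triples D.ell,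
      |lap h (tetra σ) (weighted m T τ u z.1) z.2| ≤ κ :=
    fun z hz σ hσ => P.abs_lap_le hM hz (hlow z hz) hσ
  obtain ⟨⟨z₀, π⟩, ⟨hz₀, hπ⟩, hmax⟩ := Set.exists_max_image _
    (fun w : (ℝ × Space d) × (Space d × Space d × Space d) =>
      bern D.ell h κ B p q w.2 (weighted m T τ u w.1.1) w.1.2) hfin hne
  -- At the minimizing pair `bern` is at least `M`, and each of its two penalty terms is at most `M
  -- / 4`, so the maximizer of `bern` still has a large `-z_π`.
  have hbig : M / 2 ≤ -lap h (tetra π) (weighted m T τ u z₀.1) z₀.2 := by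
    have h1 : bern D.ell h κ B p q π₁ (weighted m T τ u z₁.1) z₁.2
        ≤ bern D.ell h κ B p q π (weighted m T τ u z₀.1) z₀.2 := hmax (z₁, π₁) ⟨hz₁, hπ₁⟩
    have h2 : M ≤ bern D.ell h κ B p q π₁ (weighted m T τ u z₁.1) z₁.2 := by
      have s1 := mul_nonneg hp0 (Finset.sum_nonneg (s := triples D.ell) fun σ _ =>
        sq_nonneg (κ - lap h (tetra σ) (weighted m T τ u z₁.1) z₁.2))
      have s2 := mul_nonneg hq0 (Finset.sum_nonneg (s := Finset.univ) fun j _ =>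
        sq_nonneg (B - fd h (D.ell j) (weighted m T τ u z₁.1) z₁.2))
      rw [bern]
      linarith
    have h3 : p * ∑ σ ∈ triples D.ell, (κ - lap h (tetra σ) (weighted m T τ u z₀.1) z₀.2) ^ 2
        ≤ M / 4 := by
      have c1 : ∑ σ ∈ triples D.ell, (κ - lap h (tetra σ) (weighted m T τ u z₀.1) z₀.2) ^ 2
          ≤ (2 * d₁ + 1) ^ 3 * (4 * κ ^ 2) := by
        have hc : ((triples D.ell).card : ℝ) ≤ (2 * d₁ + 1) ^ 3 := by
          exact_mod_cast card_triples_le (ell := D.ell)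
        refine (Finset.sum_le_card_nsmul _ _ (4 * κ ^ 2) fun σ hσ => ?_).trans ?_
        · have := abs_le.1 (hlapκ z₀ hz₀ σ hσ)
          nlinarith [this.1, this.2]
        · rw [nsmul_eq_mul]
          exact mul_le_mul_of_nonneg_right hc (by positivity)
      refine (mul_le_mul_of_nonneg_left c1 hp0).trans (le_of_eq ?_)
      calc p * ((2 * d₁ + 1) ^ 3 * (4 * κ ^ 2))
          = cEps d₁ δ K₀ * (16 * (2 * d₁ + 1) ^ 3 * cRatio d₁ δ K₀) * (M / 4) := by
            rw [hp, hκ]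
            field_simp
            ring
        _ = M / 4 := by rw [hεr, one_mul]
    have h4 : q * ∑ j, (B - fd h (D.ell j) (weighted m T τ u z₀.1) z₀.2) ^ 2 ≤ M / 4 := by
      have c1 : ∑ j, (B - fd h (D.ell j) (weighted m T τ u z₀.1) z₀.2) ^ 2
          ≤ 2 * d₁ * (4 * B ^ 2) := by
        refine (Finset.sum_le_card_nsmul _ _ (4 * B ^ 2) fun j _ => ?_).trans (le_of_eq ?_)
        · have := abs_le.1 (P.bounds.fd_le z₀ hz₀ _ (ell_mem_dirs j))
          nlinarith [this.1, this.2]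
        · rw [nsmul_eq_mul, card_univ_idx]
      refine (mul_le_mul_of_nonneg_left c1 hq0).trans ?_
      have c2 : q * (2 * d₁ * (4 * B ^ 2))
          = (16 * (K₃ ^ 2 + 1) * (2 * d₁) * B) * (B / M) / 4 := by
        rw [hq]
        field_simp
        ring
      have c3 : (16 * (K₃ ^ 2 + 1) * (2 * d₁) * B) * (B / M) ≤ M * 1 :=
        mul_le_mul m4 ((div_le_one hM0).2 (by linarith)) (by positivity) hM0.le
      rw [c2]
      linarith
    have h5 := h2.trans h1
    rw [bern] at h5
    linarith
  have hint : z₀ ∈ interior₂ D T τ h Q := by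
    rcases mem_interior_or_boundary (D := D) (h := h) hz₀ with hi | hb
    · exact hi
    -- On the boundary the quadruples are at most `3 B < M / 2`.
    · have := (abs_le.1 (P.abs_lap_boundary_le hb hπ)).1
      linarith
  obtain ⟨hgt, h0t, htT⟩ := time_mem_of_mem_grid P.subset hint.1
  have hshift : ∀ y ∈ dirs D.ell, (z₀.1, z₀.2 + h • y) ∈ Q := fun y hy => P.shift_mem hint hy
  have hξ := xi_pos (m := m) (T := T) (τ := τ) (t := z₀.1)
  -- The supremum need not be attained. The tolerance `h² / 4`, divided by the weight, is such that
  -- the four increments of a quadruple, divided by `h²`, add up to at most `1`.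
  obtain ⟨_, ⟨α, rfl⟩, hα⟩ := (lt_isLUB_iff (P.solves z₀ hint.1)).1
    (show -(h ^ 2 / 4 / xi m T τ z₀.1) < 0 by
      rw [neg_lt_zero]
      positivity)
  change _ < expr D T τ h u z₀.1 z₀.2 α at hα
  set G := oper D.ell (fun k => D.a α k z₀.1) (fun k => D.b α k z₀.1) (D.c α z₀.1) (D.f α z₀.1) h
        (D.r α z₀.1 * Real.exp (-m * τ) / τ) (D.r α z₀.1 * cm m τ) (xi m T τ z₀.1)
        (weighted m T τ u z₀.1) (weighted m T τ u (z₀.1 + tauT T τ z₀.1)) with hG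
  have hG0 : -(h ^ 2 / 4) ≤ G z₀.2 := by
    rw [hG, oper_weighted P.τ_pos hgt htT]
    have := mul_le_mul_of_nonneg_left hα.le hξ.le
    have e : xi m T τ z₀.1 * -(h ^ 2 / 4 / xi m T τ z₀.1) = -(h ^ 2 / 4) := by
      field_simp
    linarith
  have hG1 : ∀ y ∈ dirs D.ell, G (z₀.2 + h • y) ≤ 0 := by
    intro y hy
    rw [hG, oper_weighted P.τ_pos hgt htT]
    exact mul_nonpos_of_nonneg_of_nonpos hξ.le (P.expr_le (hshift y hy) α)
  have hC := P.coef hh₀ α z₀.1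
  have hρ : 0 ≤ D.r α z₀.1 * Real.exp (-m * τ) / τ :=
    div_nonneg (mul_nonneg (P.basic.r_nonneg α _) (Real.exp_pos _).le) P.τ_pos.le
  refine hC.not_max_bern (φ₀ := weighted m T τ u z₀.1)
    (φ₁ := weighted m T τ u (z₀.1 + tauT T τ z₀.1)) (x := z₀.2) P.δ_pos hh hh1 hK₀ hK₃
    P.hasSplits hB1 hM ⟨?_, ?_, ?_, ?_⟩ (ζ := xi m T τ z₀.1) ?_ hρ
    (hlam.trans (lam_le P.basic.r_nonneg P.nondeg.r_le P.nondeg.c_le α z₀.1 z₀.2)) ?_ ?_ hπ hbig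
    (jump_nonpos hρ (fun k => hC.rate_nonneg hh _ k) ?_ fun k => ?_)
  · exact fun σ hσ y hy => hlapκ _ (Or.inl (hshift y hy)) σ hσ
  · exact fun k hk y hy => P.bounds.fd_le _ (Or.inl (hshift y hy)) k hk
  · exact fun y hy => P.bounds.val_le _ (Or.inl (hshift y hy))
  · exact fun y hy k hk => P.abs_mixed_le hM hlow hz₀ hy hk
  · rw [abs_of_pos hξ]
    exact P.bounds.xi_le z₀ hz₀
  · intro σ hσ
    rw [lap, div_le_one (by positivity)]
    calc _ ≤ ∑ _n : Fin 4, h ^ 2 / 4 := Finset.sum_le_sum fun n _ => by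
          have := hG1 _ (tetra_mem_dirs P.basic.ell_opp hσ n)
          linarith
      _ = h ^ 2 := by
          simp
          ring
  · intro j
    rw [fd, div_le_one hh]
    have := hG1 _ (ell_mem_dirs j)
    nlinarith
  · exact hmax ((z₀.1 + tauT T τ z₀.1, z₀.2), π) ⟨hint.2.2.1, hπ⟩
  · exact hmax ((z₀.1, z₀.2 + h • D.ell k), π) ⟨Or.inl (hshift _ (ell_mem_dirs k)), hπ⟩

/-- The second-difference estimate on the whole domain, for the weighted function. -/
theorem Problem.abs_fd_fd_le (P : Problem D T τ h η m h₀ δ K₀ K₃ B l Q u) [Nonempty A]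
    (hh₀ : 0 < h₀) (hlam : cLam d₁ δ K₀ ≤ lam D m τ) {z : ℝ × Space d}
    (hz : z ∈ barQ T τ Q) (i j : Idx d₁) :
    |fd h (D.ell j) (fd h (D.ell i) (weighted m T τ u z.1)) z.2|
      ≤ (12 * (cRatio d₁ δ K₀ * cBig d₁ δ K₀ K₃) + 2 / min h₀ 1) * B := by
  have hB1 := P.bounds.one_le
  have hB0 : 0 ≤ B := by linarith
  have hg : 0 < min h₀ 1 := lt_min hh₀ one_pos
  have hr := one_le_cRatio (d₁ := d₁) P.δ_pos P.K₀_nonneg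
  obtain ⟨hb, -⟩ := cBig_spec (d₁ := d₁) P.δ_pos P.K₀_nonneg P.K₃_nonneg (le_refl 1) le_rfl
  have h12 : 1 ≤ 12 * (cRatio d₁ δ K₀ * cBig d₁ δ K₀ K₃) := by
    have : 1 ≤ cRatio d₁ δ K₀ * cBig d₁ δ K₀ K₃ :=
      one_le_mul_of_one_le_of_one_le hr (by linarith)
    linarith
  have h2g : 0 < 2 / min h₀ 1 := by positivity
  -- The maximum principle needs `h ≤ h₀` for monotonicity and `h ≤ 1` in the error bounds. For
  -- larger `h`, dividing the first differences by `h` gives the term `2 / min h₀ 1`.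
  rcases le_or_gt h (min h₀ 1) with hh | hh
  · have key := P.abs_mixed_le (le_refl (cBig d₁ δ K₀ K₃ * B))
      (fun z hz σ hσ => (P.lap_gt (hh.trans (min_le_left _ _)) (hh.trans (min_le_right _ _)) hlam
        hz hσ).le) hz (ell_mem_dirs j) (ell_mem_dirs i)
    have := mul_nonneg h2g.le hB0
    linarith
  · rcases mem_interior_or_boundary (D := D) (h := h) hz with hi | hi
    · have b₁ := P.bounds.fd_le _ (Or.inl (P.shift_mem hi (ell_mem_dirs j))) _ (ell_mem_dirs i)
      have b₂ := P.bounds.fd_le _ hz _ (ell_mem_dirs i)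
      simp only at b₁
      rw [fd, abs_div, abs_of_pos P.h_pos]
      calc _ ≤ (B + B) / h := div_le_div_of_nonneg_right
            ((abs_sub _ _).trans (add_le_add b₁ b₂)) P.h_pos.le
        _ ≤ (B + B) / min h₀ 1 := div_le_div_of_nonneg_left (by linarith) hg hh.le
        _ = 2 / min h₀ 1 * B := by ring
        _ ≤ _ := mul_le_mul_of_nonneg_right (by linarith) hB0
    · refine (P.bounds.mixed_le z hi _ (ell_mem_dirs j) _ (ell_mem_dirs i)).trans ?_
      exact le_mul_of_one_le_left hB0 (by linarith)

end Estimate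

end FDBellman
end

theorem theorem10p4p1 (d₁ : ℕ) (δ K₀ : ℝ) (hδ : 0 < δ) (hδ1 : δ ≤ 1) (hK₀ : 0 ≤ K₀) :
    ∃ N : ℝ, ∀ h₀ K₃ : ℝ, 0 < h₀ → 0 ≤ K₃ →
      ∃ Nstar : ℝ,
        ∀ (A : Type*) [MetricSpace A] [TopologicalSpace.SeparableSpace A] [Nonempty A]
          (d : ℕ) (D : FDBellman.Data A d d₁)
          (T τ h η m : ℝ) (l : FDBellman.Space d)
          (Q : Set (ℝ × FDBellman.Space d)) (u : ℝ → FDBellman.Space d → ℝ),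
          0 < T → 0 < τ → 0 < h → 0 < η → η ≤ h → ‖l‖ ≤ K₀ →
          FDBellman.Basic D K₀ K₃ →
          FDBellman.RootLipschitz D K₀ →
          FDBellman.Monotone D h₀ →
          FDBellman.SecondDiffs D h η l K₀ K₃ →
          FDBellman.Nondegenerate D δ K₀ K₃ →
          FDBellman.GridStructure D →
          Q.Finite → Q ⊆ FDBellman.grid D T τ h η l →
          (∃ x, ((0 : ℝ), x) ∈ Q) →
          (∀ z ∈ Q, FDBellman.SolvesAt D T τ h u z.1 z.2) →
          N ≤ FDBellman.lam D m τ →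
          ∀ x, ((0 : ℝ), x) ∈ Q → ∀ i j : FDBellman.Idx d₁,
            |FDBellman.fd h (D.ell j) (FDBellman.fd h (D.ell i) (u 0)) x| ≤
              Nstar * Real.exp (max m 0 * (T + τ)) * FDBellman.R D m T τ h Q u := by
  refine ⟨FDBellman.cLam d₁ δ K₀, fun h₀ K₃ hh₀ hK₃ =>
    ⟨12 * (FDBellman.cRatio d₁ δ K₀ * FDBellman.cBig d₁ δ K₀ K₃) + 2 / min h₀ 1, ?_⟩⟩
  intro A _ _ _ d D T τ h η m l Q u hT hτ hh _ _ _ hBasic hRoot hMon hSec hNon hGrid hfin hQ _ hu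
    hlam x hx i j
  have P : FDBellman.Problem D T τ h η m h₀ δ K₀ K₃ (FDBellman.dataBound D m T τ h Q u) l Q u :=
    ⟨hT, hτ, hh, hδ, hδ1, hK₀, hK₃, hBasic, hRoot, hMon, hSec, hNon, hGrid, hfin, hQ, hu,
      FDBellman.weightedBounds hT hτ hfin hQ⟩
  have key := P.abs_fd_fd_le hh₀ hlam (z := (0, x)) (Or.inl hx) i j
  have e : FDBellman.weighted m T τ u 0 = u 0 := by
    funext y
    rw [FDBellman.weighted, FDBellman.xi_zero hT, one_mul]
  simp only [e] at key
  rw [mul_assoc]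
  exact key
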